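/- Let $p,q,\Delta\in\mathbb{C}(x,t)$. Let $T\subseteq\mathbb{C}\setminus\{0\}$ be open and connected (for instance a small punctured disc $0<|t|<\varepsilon$), let $\rho,R:T\to\mathbb{R}$ be continuous with $0\le\rho(t)<R(t)$, and let $$D=\{(x,t): t\in T,\ \rho(t)<|x|<R(t)\}.$$ Suppose that $\log(p+q\sqrt\Delta)$ has no singularity in $D$ and that $p+q\sqrt\Delta$ is single valued there, i.e. let $f$ be a nowhere vanishing holomorphic function on $D$ which at every point of $D$ where $p,q,\Delta$ are defined equals $p+qw$ for some square root $w$ of $\Delta$. Then there is a unique integer $k$ such that for every integer $i$ and every $t\in T$ the function $x\mapsto x^{-k}t^{-i}f(x,t)$ has a holomorphic logarithm $L(\cdot,t)$ on the annulus $\rho(t)<|x|<R(t)$, so that $\log f=L+k\log x+i\log t$. For any such $k,i$ and $L$, let $L(x,t)=\sum_{j\in\mathbb{Z}}a_j(t)x^j$ be the Laurent expansion of $L(\cdot,t)$ on this annulus, and put $$L_+=\sum_{j>0}a_j(t)x^j,\qquad L_0=a_0(t),\qquad L_-=\sum_{j<0}a_j(t)x^j .$$ Then $f=x^kt^ie^{L_-}e^{L_0}e^{L_+}$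 on $D$, and each of $e^{L_+}$, $e^{L_-}$, $e^{L_0}$ is D-algebraic over $x,t$. Here $g$ is called D-algebraic over $x,t$ if it is holomorphic on $D$ and there are two nonzero polynomials $P_1,P_2$, in finitely many variables and with coefficients in $\mathbb{C}(x,t)$, such that $$P_1\Big(g,\frac{\partial g}{\partial x},\dots,\frac{\partial^n g}{\partial x^n}\Big)=0\quad\text{and}\quad P_2\Big(g,\frac{\partial g}{\partial t},\dots,\frac{\partial^n g}{\partial t^n}\Big)=0\quad\text{on } D.$$ -/

import Mathlib

/-- The polynomial ring `ℂ[x, t]`; the variable `0` is `x` and the variable `1` is `t`. -/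
abbrev PolyXT : Type := MvPolynomial (Fin 2) ℂ

/-- The field `ℂ(x, t)` of rational functions in `x` and `t`. -/
abbrev RatXT : Type := FractionRing PolyXT

/-- The value of a polynomial of `ℂ[x, t]` at the point `(x, t)`. -/
noncomputable def polyVal (x t : ℂ) : PolyXT →+* ℂ := MvPolynomial.eval ![x, t]

/-- The point `(x, t)` is not a zero of the reduced denominator of `r`. -/
def RatXT.RegularAt (r : RatXT) (x t : ℂ) : Prop :=
  polyVal x t (IsFractionRing.den PolyXT r : PolyXT) ≠ 0

/-- The value of `r` at `(x, t)`, meaningful where `r` is regular. -/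
noncomputable def RatXT.val (r : RatXT) (x t : ℂ) : ℂ :=
  polyVal x t (IsFractionRing.num PolyXT r) / polyVal x t (IsFractionRing.den PolyXT r : PolyXT)

/-- The open annulus `a < |x| < b` in the `x`-plane. -/
def openAnnulus (a b : ℝ) : Set ℂ := {x | a < ‖x‖ ∧ ‖x‖ < b}

/-- The set of all `(x, t)` with `t ∈ T` and `ρ t < |x| < R t`. -/
def annularDomain (T : Set ℂ) (ρ R : ℂ → ℝ) : Set (ℂ × ℂ) :=
  {z | z.2 ∈ T ∧ z.1 ∈ openAnnulus (ρ z.2) (R z.2)}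

/-- `f` is a (single-valued) holomorphic branch of `p + q √Δ` on `D`: it is holomorphic on `D`, and
at each point of `D` where `p`, `q`, `Δ` are defined it is `p + q w` for a square root `w` of `Δ`. -/
def IsBranchOn (p q Δ : RatXT) (D : Set (ℂ × ℂ)) (f : ℂ → ℂ → ℂ) : Prop :=
  AnalyticOnNhd ℂ (fun z : ℂ × ℂ => f z.1 z.2) D ∧
  ∀ x t : ℂ, (x, t) ∈ D → p.RegularAt x t → q.RegularAt x t → Δ.RegularAt x t →
    ∃ w : ℂ, w ^ 2 = Δ.val x t ∧ f x t = p.val x t + q.val x t * w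

/-- For every `t ∈ T`, `L(·, t)` is a holomorphic branch of `log f - k log x - i log t` on the
annulus `ρ t < |x| < R t`, that is, `f = x ^ k * t ^ i * e ^ L` there. -/
def IsLogOn (T : Set ℂ) (ρ R : ℂ → ℝ) (f : ℂ → ℂ → ℂ) (k i : ℤ) (L : ℂ → ℂ → ℂ) : Prop :=
  ∀ t ∈ T, DifferentiableOn ℂ (fun x => L x t) (openAnnulus (ρ t) (R t)) ∧
    ∀ x ∈ openAnnulus (ρ t) (R t), f x t = x ^ k * t ^ i * Complex.exp (L x t)

/-- The coefficient of `x ^ j` in the Laurent expansion of `g` on the annulus `a < |x| < b`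
(for `g` holomorphic there, any radius between `a` and `b` gives the same value). -/
noncomputable def laurentCoeff (a b : ℝ) (g : ℂ → ℂ) (j : ℤ) : ℂ :=
  (2 * (Real.pi : ℂ) * Complex.I)⁻¹ * ∮ s in C(0, (a + b) / 2), s ^ (-j - 1) * g s

/-- `[x^>] g`: the terms of positive degree of the Laurent expansion on `a < |x| < b`. -/
noncomputable def posPart (a b : ℝ) (g : ℂ → ℂ) (x : ℂ) : ℂ :=
  ∑' n : ℕ, laurentCoeff a b g ((n : ℤ) + 1) * x ^ ((n : ℤ) + 1)

/-- `[x^<] g`: the terms of negative degree of the Laurent expansion on `a < |x| < b`. -/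
noncomputable def negPart (a b : ℝ) (g : ℂ → ℂ) (x : ℂ) : ℂ :=
  ∑' n : ℕ, laurentCoeff a b g (-((n : ℤ) + 1)) * x ^ (-((n : ℤ) + 1))

/-- `L₊(x, t)`, with the Laurent expansion in `x` on the annulus `ρ t < |x| < R t`. -/
noncomputable def logPos (ρ R : ℂ → ℝ) (L : ℂ → ℂ → ℂ) (x t : ℂ) : ℂ :=
  posPart (ρ t) (R t) (fun s => L s t) x

/-- `L₋(x, t)`, with the Laurent expansion in `x` on the annulus `ρ t < |x| < R t`. -/
noncomputable def logNeg (ρ R : ℂ → ℝ) (L : ℂ → ℂ → ℂ) (x t : ℂ) : ℂ :=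
  negPart (ρ t) (R t) (fun s => L s t) x

/-- `L₀(t)`, regarded as a function of `(x, t)` that does not depend on `x`. -/
noncomputable def logZero (ρ R : ℂ → ℝ) (L : ℂ → ℂ → ℂ) (_x t : ℂ) : ℂ :=
  laurentCoeff (ρ t) (R t) (fun s => L s t) 0

/-- `g` satisfies on `D` a nontrivial polynomial equation `P(g, ∂g/∂x, ∂²g/∂x², …) = 0`. The
coefficients of `P` are in `ℂ[x, t]`, which, denominators being cleared, is the same as in
`ℂ(x, t)`. -/
def SatisfiesADEInX (D : Set (ℂ × ℂ)) (g : ℂ → ℂ → ℂ) : Prop :=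
  ∃ P : MvPolynomial ℕ PolyXT, P ≠ 0 ∧ ∀ x t : ℂ, (x, t) ∈ D →
    MvPolynomial.eval₂ (polyVal x t) (fun n => iteratedDeriv n (fun s => g s t) x) P = 0

/-- `g` satisfies on `D` a nontrivial polynomial equation `P(g, ∂g/∂t, ∂²g/∂t², …) = 0` with
coefficients in `ℂ[x, t]`. -/
def SatisfiesADEInT (D : Set (ℂ × ℂ)) (g : ℂ → ℂ → ℂ) : Prop :=
  ∃ P : MvPolynomial ℕ PolyXT, P ≠ 0 ∧ ∀ x t : ℂ, (x, t) ∈ D →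
    MvPolynomial.eval₂ (polyVal x t) (fun n => iteratedDeriv n (fun s => g x s) t) P = 0

/-- The function `g` is holomorphic on `D` and D-algebraic over `x, t`: there is one algebraic
differential equation for each of the two variables. -/
def IsDAlgebraicOn (D : Set (ℂ × ℂ)) (g : ℂ → ℂ → ℂ) : Prop :=
  AnalyticOnNhd ℂ (fun z : ℂ × ℂ => g z.1 z.2) D ∧ SatisfiesADEInX D g ∧ SatisfiesADEInT D g

/-! ### Creative telescoping by counting dimensions. -/

section Telescoper
open Polynomial

variable {S : Type*} [CommRing S] {ι : Type*} [Fintype ι]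

/-! The integer `k` is the winding number of `f(·, t)` on the annulus. Pulled back by `exp`, the
annulus becomes a convex strip, on which `f` has a logarithm; its defect under translation by `2πi`
is `2πi k`. This number is locally constant in `t`, hence constant on the connected set `T`. The
factorization is then the Laurent expansion of `L(·, t)`, exponentiated.

For D-algebraicity, put `F = x ^ (-k) t ^ (-i) f`. Each Laurent part of `L` is a contour integral
`(2πi)⁻¹ ∮ L(s, t) κ(s, x) ds` with a rational kernel `κ` whose poles lie at `s = 0` and `s = x`.
The given `L` need not be regular in `t`, so it is replaced locally by a logarithm `M` of `F`
analytic in both variables. Since `∮ κ` is in `2πi ℤ`, this moves the exponent by a multiple of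
`2πi` only (`eventually_exp_part_eq`).

As `F` is at most quadratic over the rational functions, its logarithmic derivatives are
combinations of `1` and `w` with `w ^ 2 = δ`. So `1, w, M` span a differential module over the
rational functions (`IsQuadraticOn.dirDeriv_log`, `exists_logMatrix`), and it contains the integrand
`G`. Let `τ` be the parameter, `x` or `t`. About `N ^ 2` mixed derivatives of `G` in `τ` and `s`
have, over a common denominator, numerators of degree `O(N)` in `s`. Hence they satisfy a relation
with coefficients free of `s` (`exists_telescoper`). Multiplication by a suitable `s ^ m` and
integration by parts over the circle turn it into a linear differential equation in `τ` for the
integral (`exists_linearODE_circleIntegral`).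

Only derivatives of order at least one occur in that equation. For `g = exp Λ` these derivatives of
`Λ` are differential polynomials in `g` divided by powers of `g`, so a linear equation for `Λ'`
becomes a nonzero algebraic one for `g` (`eval₂_expODE`, `expODE_ne_zero`). It depends on the module
and the kernel alone, not on the circle, the point or the choice of `M`, so it is valid on all of
`D`. -/

/-- Apply `d` to every coefficient of a polynomial. -/
noncomputable def coeffDer (d : Derivation ℂ PolyXT PolyXT) (Q : PolyXT[X]) : PolyXT[X] :=
  Q.sum fun n a => monomial n (d a)

theorem coeff_coeffDer (d : Derivation ℂ PolyXT PolyXT) (Q : PolyXT[X]) (n : ℕ) :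
    (coeffDer d Q).coeff n = d (Q.coeff n) := by
  rw [coeffDer, Polynomial.sum, finsetSum_coeff]
  simp only [coeff_monomial]
  rw [Finset.sum_ite_eq' Q.support n (fun m => d (Q.coeff m))]
  split_ifs with h
  · rfl
  · rw [notMem_support_iff.1 h, map_zero]

theorem natDegree_coeffDer_le (d : Derivation ℂ PolyXT PolyXT) (Q : PolyXT[X]) :
    (coeffDer d Q).natDegree ≤ Q.natDegree := by
  rw [natDegree_le_iff_coeff_eq_zero]
  intro n hn
  rw [coeff_coeffDer, coeff_eq_zero_of_natDegree_lt hn, map_zero]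

theorem coeffDer_add (d : Derivation ℂ PolyXT PolyXT) (P Q : PolyXT[X]) :
    coeffDer d (P + Q) = coeffDer d P + coeffDer d Q := by
  ext n; simp [coeff_coeffDer]

theorem coeffDer_monomial (d : Derivation ℂ PolyXT PolyXT) (n : ℕ) (a : PolyXT) :
    coeffDer d (monomial n a) = monomial n (d a) := by
  ext m
  rw [coeff_coeffDer, coeff_monomial, coeff_monomial]
  split_ifs <;> simp

/-- If `U ∂Y = A Y` and `U ^ n F = v ⬝ Y`, then `U ^ (n + 1) ∂F = derivStep D U A n v ⬝ Y`,
where `D` is the action of `∂` on polynomials. -/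
noncomputable def derivStep (D : S[X] → S[X]) (U : S[X]) (A : ι → ι → S[X]) (n : ℕ)
    (v : ι → S[X]) : ι → S[X] :=
  fun a => U * D (v a) + ∑ b, v b * A b a - n * D U * v a

/-- Each differentiation costs one factor `U` or one matrix entry, so the degree grows by at most
`m`: linearly in the order. The scalar `k` does not affect the bound. -/
theorem natDegree_derivStep_le (D : S[X] → S[X]) (hD : ∀ Q, (D Q).natDegree ≤ Q.natDegree)
    {U : S[X]} {A : ι → ι → S[X]} {m n : ℕ} {v : ι → S[X]} (hU : U.natDegree ≤ m)
    (hA : ∀ a b, (A a b).natDegree ≤ m) (hv : ∀ a, (v a).natDegree ≤ m * n) (k : ℕ) (a : ι) :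
    (derivStep D U A k v a).natDegree ≤ m * (n + 1) := by
  have e : m * (n + 1) = m + m * n := by ring
  refine (natDegree_sub_le_of_le (m := m * (n + 1)) ?_ ?_).trans (max_self _).le
  · refine (natDegree_add_le_of_degree_le ?_ ?_)
    · rw [e]; exact natDegree_mul_le_of_le hU ((hD _).trans (hv a))
    · refine natDegree_sum_le_of_forall_le _ _ fun b _ => ?_
      rw [mul_add, mul_one]; exact natDegree_mul_le_of_le (hv b) (hA b a)
  · rw [e]
    refine natDegree_mul_le_of_le ?_ (hv a)
    refine (natDegree_mul_le_of_le (natDegree_natCast k).le ((hD _).trans hU)).trans (by simp)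

/-- The vectors `v_j` with `U ^ (j + 1) ∂ₛ ^ j G = v_j ⬝ Y`. -/
noncomputable def derivVecLeft (U : S[X]) (A : ι → ι → S[X]) (v : ι → S[X]) : ℕ → ι → S[X]
  | 0 => v
  | j + 1 => derivStep (fun Q => derivative Q) U A (j + 1) (derivVecLeft U A v j)

/-- The vectors `v_{ij}` with `U ^ (i + j + 1) ∂_τ ^ i ∂ₛ ^ j G = v_{ij} ⬝ Y`. -/
noncomputable def derivVec (D : S[X] → S[X]) (U : S[X]) (A B : ι → ι → S[X]) (v : ι → S[X])
    (j : ℕ) : ℕ → ι → S[X]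
  | 0 => derivVecLeft U A v j
  | i + 1 => derivStep D U B (i + j + 1) (derivVec D U A B v j i)

theorem natDegree_derivVecLeft_le {U : S[X]} {A : ι → ι → S[X]} {m : ℕ} {v : ι → S[X]}
    (hU : U.natDegree ≤ m) (hA : ∀ a b, (A a b).natDegree ≤ m) (hv : ∀ a, (v a).natDegree ≤ m)
    (j : ℕ) (a : ι) : (derivVecLeft U A v j a).natDegree ≤ m * (j + 1) := by
  induction j generalizing a with
  | zero => simpa [derivVecLeft] using hv a
  | succ j ih =>
    exact natDegree_derivStep_le _
      (fun Q => (natDegree_derivative_le Q).trans (Nat.sub_le _ _)) hU hA ih _ a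

theorem natDegree_derivVec_le (D : S[X] → S[X]) (hD : ∀ Q, (D Q).natDegree ≤ Q.natDegree)
    {U : S[X]} {A B : ι → ι → S[X]} {m : ℕ} {v : ι → S[X]}
    (hU : U.natDegree ≤ m) (hA : ∀ a b, (A a b).natDegree ≤ m)
    (hB : ∀ a b, (B a b).natDegree ≤ m) (hv : ∀ a, (v a).natDegree ≤ m)
    (i j : ℕ) (a : ι) : (derivVec D U A B v j i a).natDegree ≤ m * (i + j + 1) := by
  induction i generalizing a with
  | zero => simpa [derivVec] using natDegree_derivVecLeft_le hU hA hv j a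
  | succ i ih =>
    rw [show i + 1 + j + 1 = i + j + 1 + 1 by ring]
    exact natDegree_derivStep_le D hD hU hB ih _ a

/-- More polynomial vectors than the dimension of the space that contains them are linearly
dependent over the coefficient ring. -/
theorem exists_relation_of_natDegree_lt [Nontrivial S] {α : Type*} [Fintype α] {K : ℕ}
    (w : α → ι → S[X]) (hw : ∀ p a, (w p a).natDegree < K)
    (hcard : Fintype.card ι * K < Fintype.card α) :
    ∃ c : α → S, c ≠ 0 ∧ ∀ a, ∑ p, C (c p) * w p a = 0 := by
  let f : (α → S) →ₗ[S] (ι × Fin K → S) :=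
    { toFun := fun c q => ∑ p, c p * (w p q.1).coeff q.2
      map_add' := fun c c' => by ext q; simp [add_mul, Finset.sum_add_distrib]
      map_smul' := fun r c => by ext q; simp [Finset.mul_sum, mul_assoc] }
  -- Over a nontrivial commutative ring, an injective map between finite free modules cannot lower
  -- the rank.
  have hf : ¬ Function.Injective f := fun h => by
    have := card_le_of_injective S f h
    rw [Fintype.card_prod, Fintype.card_fin] at this
    omega
  rw [injective_iff_map_eq_zero] at hf
  push Not at hf
  obtain ⟨c, hc, hc0⟩ := hf
  refine ⟨c, hc0, fun a => ?_⟩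
  ext n
  rw [finsetSum_coeff, coeff_zero]
  by_cases hn : n < K
  · have := congrFun hc (a, ⟨n, hn⟩)
    simpa [f, coeff_C_mul] using this
  · refine Finset.sum_eq_zero fun p _ => ?_
    rw [coeff_C_mul, coeff_eq_zero_of_natDegree_lt ((hw p a).trans_le (not_lt.1 hn)), mul_zero]

/-- There are `N ^ 2` vectors, while the space of numerators has dimension linear in `N`. The power
of `U` brings every derivative to the common denominator `U ^ (2 * N + 1)`; since `p.1 + 1 + p.2 < 2
* N`, the subtraction does not truncate. The order in the parameter starts at `1` because only
derivatives of a logarithm can be expressed through its exponential. -/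
theorem exists_telescoper [Nontrivial S] (D : S[X] → S[X])
    (hD : ∀ Q, (D Q).natDegree ≤ Q.natDegree) (U : S[X]) (A B : ι → ι → S[X]) (v : ι → S[X]) :
    ∃ (N : ℕ) (c : Fin N × Fin N → S), c ≠ 0 ∧ ∀ a, ∑ p : Fin N × Fin N,
      C (c p) * (U ^ (2 * N - (p.1 + 1 + p.2)) * derivVec D U A B v p.2 (p.1 + 1) a) = 0 := by
  obtain ⟨m, hU, hA, hB, hv⟩ : ∃ m, U.natDegree ≤ m ∧ (∀ a b, (A a b).natDegree ≤ m) ∧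
      (∀ a b, (B a b).natDegree ≤ m) ∧ ∀ a, (v a).natDegree ≤ m := by
    refine ⟨U.natDegree + ∑ a, ∑ b, (A a b).natDegree + ∑ a, ∑ b, (B a b).natDegree +
      ∑ a, (v a).natDegree, by omega, fun a b => ?_, fun a b => ?_, fun a => ?_⟩
    · have h1 := Finset.single_le_sum (f := fun b => (A a b).natDegree)
        (fun _ _ => Nat.zero_le _) (Finset.mem_univ b)
      have h2 := Finset.single_le_sum (f := fun a => ∑ b, (A a b).natDegree)
        (fun _ _ => Nat.zero_le _) (Finset.mem_univ a)
      omega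
    · have h1 := Finset.single_le_sum (f := fun b => (B a b).natDegree)
        (fun _ _ => Nat.zero_le _) (Finset.mem_univ b)
      have h2 := Finset.single_le_sum (f := fun a => ∑ b, (B a b).natDegree)
        (fun _ _ => Nat.zero_le _) (Finset.mem_univ a)
      omega
    · have h1 := Finset.single_le_sum (f := fun a => (v a).natDegree)
        (fun _ _ => Nat.zero_le _) (Finset.mem_univ a)
      omega
  set k := Fintype.card ι
  -- Chosen so that `N ^ 2 = N * k * (3 * m + 1) + N`, which exceeds `k * (m * (2 * N + 1) + 1) ≤ N
  -- * k * (3 * m + 1)`.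
  set N := k * (3 * m + 1) + 1 with hN
  refine ⟨N, exists_relation_of_natDegree_lt (K := m * (2 * N + 1) + 1)
    (fun (p : Fin N × Fin N) a =>
      U ^ (2 * N - (p.1 + 1 + p.2)) * derivVec D U A B v p.2 (p.1 + 1) a) (fun p a => ?_) ?_⟩
  · refine Nat.lt_succ_of_le ?_
    have h1 := natDegree_derivVec_le D hD hU hA hB hv (p.1 + 1) p.2 a
    have h2 : (U ^ (2 * N - (p.1 + 1 + p.2))).natDegree ≤ (2 * N - (p.1 + 1 + p.2)) * m :=
      natDegree_pow_le_of_le _ hU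
    refine (natDegree_mul_le_of_le h2 h1).trans ?_
    have hp1 := p.1.2
    have hp2 := p.2.2
    rw [mul_comm, ← mul_add]
    exact Nat.mul_le_mul_left _ (by omega)
  · rw [Fintype.card_prod, Fintype.card_fin]
    change k * (m * (2 * N + 1) + 1) < N * N
    have h1 : 1 ≤ N := by omega
    have : N * N = N * (k * (3 * m + 1)) + N := by
      conv_lhs => rw [hN]
      rw [← hN]; ring
    have h2 : k * (m * (2 * N + 1) + 1) ≤ N * (k * (3 * m + 1)) := by
      calc k * (m * (2 * N + 1) + 1) ≤ k * (m * (2 * N + N) + N) := by gcongr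
        _ = N * (k * (3 * m + 1)) := by ring
    omega

end Telescoper

/-! ### From a linear equation for `Λ'` to an algebraic equation for `exp Λ`. -/

section ExpADE
open MvPolynomial

variable (S : Type*) [CommRing S]

/-- The total derivative `X n ↦ X (n + 1)` on differential polynomials, `S` being constant. -/
noncomputable def totalDer : Derivation S (MvPolynomial ℕ S) (MvPolynomial ℕ S) :=
  mkDerivation S fun n => X (n + 1)

/-- With `X n` read as the `n`-th derivative of `g`, the polynomial `logDerNum S n` is
`g ^ (n + 1)` times the `n`-th derivative of `g' / g`. -/
noncomputable def logDerNum : ℕ → MvPolynomial ℕ S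
  | 0 => X 1
  | n + 1 => X 0 * totalDer S (logDerNum n) - ((n + 1 : ℕ) : MvPolynomial ℕ S) * (X 1 * logDerNum n)

/-- The commutator of two derivations is a derivation, so it suffices to compare both sides on the
variables. -/
theorem pderiv_totalDer (m : ℕ) (P : MvPolynomial ℕ S) :
    pderiv (m + 1) (totalDer S P) = totalDer S (pderiv (m + 1) P) + pderiv m P := by
  have h : ⁅pderiv (R := S) (m + 1), totalDer S⁆ = pderiv (R := S) m := by
    apply MvPolynomial.derivation_ext
    intro n
    rw [Derivation.commutator_apply, totalDer, mkDerivation_X, pderiv_X, pderiv_X, pderiv_X]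
    by_cases hn : n = m
    · subst hn
      simp
    · by_cases h3 : n = m + 1
      · subst h3; simp
      · simp [hn, h3]
  rw [← h, Derivation.commutator_apply]
  ring

theorem pderiv_logDerNum_of_lt {n m : ℕ} (h : n + 1 < m) : pderiv m (logDerNum S n) = 0 := by
  induction n generalizing m with
  | zero =>
    rw [logDerNum, pderiv_X_of_ne (by omega)]
  | succ n ih =>
    obtain ⟨m, rfl⟩ : ∃ k, m = k + 1 := ⟨m - 1, by omega⟩
    rw [logDerNum, map_sub, Derivation.leibniz, Derivation.leibniz, Derivation.leibniz,
      pderiv_totalDer, ih (by omega), ih (by omega), pderiv_X_of_ne (by omega),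
      pderiv_X_of_ne (by omega), Derivation.map_natCast]
    simp

/-- Together with `pderiv_logDerNum_of_lt` this says that `X (n + 1)` is the highest variable of
`logDerNum S n`, with separant `X 0 ^ n`. That separates the summands of `expODE`. -/
theorem pderiv_logDerNum (n : ℕ) : pderiv (n + 1) (logDerNum S n) = X 0 ^ n := by
  induction n with
  | zero => simp [logDerNum]
  | succ n ih =>
    rw [logDerNum, map_sub, Derivation.leibniz, Derivation.leibniz, Derivation.leibniz,
      pderiv_totalDer, pderiv_logDerNum_of_lt S (by omega), ih, pderiv_X_of_ne (by omega),
      pderiv_X_of_ne (by omega), Derivation.map_natCast]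
    simp [pow_succ']

/-- The differential polynomial which at `g = exp Λ` is `g ^ N * ∑ c i * Λ ^ (i + 1)`. -/
noncomputable def expODE {N : ℕ} (c : Fin N → S) : MvPolynomial ℕ S :=
  ∑ i : Fin N, C (c i) * (X 0 ^ (N - 1 - i) * logDerNum S i)

theorem expODE_ne_zero [IsDomain S] {N : ℕ} {c : Fin N → S} (hc : c ≠ 0) : expODE S c ≠ 0 := by
  classical
  have hne : (Finset.univ.filter fun i => c i ≠ 0).Nonempty := by
    obtain ⟨i, hi⟩ := Function.ne_iff.1 hc
    exact ⟨i, by simpa using hi⟩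
  -- For the largest `i` with `c i ≠ 0`, no other summand involves `X (i + 1)`, and the partial
  -- derivative in that variable is `c i * X 0 ^ (N - 1)`.
  obtain ⟨i, hi, hmax⟩ := Finset.exists_max_image _ (fun i => i) hne
  intro h0
  have h := congrArg (pderiv ((i : ℕ) + 1)) h0
  rw [expODE, map_sum, map_zero, Finset.sum_eq_single i] at h
  · rw [Derivation.leibniz, pderiv_C, Derivation.leibniz, pderiv_logDerNum, Derivation.leibniz_pow,
      pderiv_X_of_ne (by omega)] at h
    simp at h
    simp [h] at hi
  · intro j _ hj
    by_cases hcj : c j = 0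
    · simp [hcj]
    · have hlt : j < i := lt_of_le_of_ne (hmax j (by simpa using hcj)) hj
      rw [Derivation.leibniz, pderiv_C, Derivation.leibniz,
        pderiv_logDerNum_of_lt S (by simpa using hlt), Derivation.leibniz_pow,
        pderiv_X_of_ne (by omega)]
      simp
  · simp

variable {S}

/-- The chain rule with the coefficients frozen through `e`. This suffices because it is applied to
`logDerNum`, whose coefficients are integers. -/
theorem hasDerivAt_eval₂_totalDer (e : S →+* ℂ) {y : ℕ → ℂ → ℂ} {τ : ℂ}
    (hy : ∀ n, HasDerivAt (y n) (y (n + 1) τ) τ) (P : MvPolynomial ℕ S) :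
    HasDerivAt (fun σ => eval₂ e (fun n => y n σ) P)
      (eval₂ e (fun n => y n τ) (totalDer S P)) τ := by
  induction P using MvPolynomial.induction_on with
  | C a => simpa [totalDer] using hasDerivAt_const τ (e a)
  | add p q hp hq =>
    simp only [eval₂_add, map_add]
    exact hp.add hq
  | mul_X p n hp =>
    have := hp.mul (hy n)
    rw [Derivation.leibniz, totalDer, mkDerivation_X, eval₂_add, smul_eq_mul, smul_eq_mul,
      eval₂_mul, eval₂_mul, eval₂_X, eval₂_X]
    refine (this.congr_deriv ?_).congr_of_eventuallyEq (.of_forall fun σ => ?_)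
    · rw [totalDer]; ring
    · simp

open Topology in
-- Since `g' / g = Λ'`, this is the recursion obtained by differentiating `g ^ (n + 1) * Λ^(n + 1)`,
-- where the last exponent denotes a derivative. Equality near `τ`, not just at `τ`, is what lets
-- the induction differentiate it.
theorem eval₂_logDerNum (e : S →+* ℂ) {g Λ : ℂ → ℂ} {τ : ℂ} (hΛ : AnalyticAt ℂ Λ τ)
    (hg : g =ᶠ[𝓝 τ] fun σ => Complex.exp (Λ σ)) (n : ℕ) :
    ∀ᶠ σ in 𝓝 τ, eval₂ e (fun n => iteratedDeriv n g σ) (logDerNum S n) =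
      g σ ^ (n + 1) * iteratedDeriv (n + 1) Λ σ := by
  have hga : AnalyticAt ℂ g τ := (hΛ.cexp).congr hg.symm
  have hd : ∀ {h : ℂ → ℂ}, AnalyticAt ℂ h τ → ∀ᶠ σ in 𝓝 τ, ∀ n,
      HasDerivAt (iteratedDeriv n h) (iteratedDeriv (n + 1) h σ) σ := by
    intro h hh
    filter_upwards [hh.eventually_analyticAt] with σ hσ n
    rw [iteratedDeriv_succ]
    have : AnalyticAt ℂ (iteratedDeriv n h) σ := by
      rw [iteratedDeriv_eq_iterate]; exact hσ.iterated_deriv n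
    exact this.differentiableAt.hasDerivAt
  have hg1 : ∀ᶠ σ in 𝓝 τ, iteratedDeriv 1 g σ = g σ * iteratedDeriv 1 Λ σ := by
    filter_upwards [hg.eventually_nhds, hΛ.eventually_analyticAt] with σ h1 h2
    rw [iteratedDeriv_one, iteratedDeriv_one, Filter.EventuallyEq.deriv_eq h1,
      Filter.Eventually.self_of_nhds h1]
    exact (h2.differentiableAt.hasDerivAt.cexp).deriv
  induction n with
  | zero => filter_upwards [hg1] with σ h; simpa [logDerNum] using h
  | succ n ih =>
    filter_upwards [ih.eventually_nhds, hg1, hd hga, hd hΛ] with σ h1 h2 h3 h4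
    have h5 := (hasDerivAt_eval₂_totalDer e h3 (logDerNum S n)).unique
      ((((h3 0).pow (n + 1)).mul (h4 (n + 1))).congr_of_eventuallyEq
        (h1.mono fun x hx => by simpa [iteratedDeriv_zero] using hx))
    rw [logDerNum]
    simp only [eval₂_sub, eval₂_mul, eval₂_X, eval₂_natCast, h5, h1.self_of_nhds,
      iteratedDeriv_zero, zero_add, h2]
    push_cast
    simp only [Pi.pow_apply]
    ring

open Topology in
/-- A linear differential equation for `Λ'` gives an algebraic one for `exp Λ`. -/
theorem eval₂_expODE (e : S →+* ℂ) {g Λ : ℂ → ℂ} {τ : ℂ} (hΛ : AnalyticAt ℂ Λ τ)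
    (hg : g =ᶠ[𝓝 τ] fun σ => Complex.exp (Λ σ)) {N : ℕ} (c : Fin N → S)
    (h : ∑ i : Fin N, e (c i) * iteratedDeriv (i + 1) Λ τ = 0) :
    eval₂ e (fun n => iteratedDeriv n g τ) (expODE S c) = 0 := by
  rw [expODE, eval₂_sum]
  calc _ = ∑ i : Fin N, g τ ^ N * (e (c i) * iteratedDeriv (i + 1) Λ τ) := by
        refine Finset.sum_congr rfl fun i _ => ?_
        rw [eval₂_mul, eval₂_mul, eval₂_pow, eval₂_X, eval₂_C, iteratedDeriv_zero,
          (eval₂_logDerNum e hΛ hg i).self_of_nhds]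
        have : g τ ^ N = g τ ^ (N - 1 - i) * g τ ^ ((i : ℕ) + 1) := by
          rw [← pow_add]; congr 1; omega
        rw [this]; ring
    _ = 0 := by rw [← Finset.mul_sum, h, mul_zero]

end ExpADE

/-! ### Circle integrals depending on a parameter; integration by parts. -/

section CircleIntegralParam
open Metric Topology Complex

theorem eventually_forall_sphere {E : Type*} [TopologicalSpace E] {Ω : Set (ℂ × E)} (hΩ : IsOpen Ω) {r : ℝ} {e₀ : E}
    (h : ∀ s ∈ sphere (0 : ℂ) r, (s, e₀) ∈ Ω) :
    ∀ᶠ e in 𝓝 e₀, ∀ s ∈ sphere (0 : ℂ) r, (s, e) ∈ Ω := by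
  refine (isCompact_sphere (0 : ℂ) r).eventually_forall_of_forall_eventually fun s hs => ?_
  exact (continuous_swap.tendsto (e₀, s)).eventually (hΩ.mem_nhds (h s hs))

variable {E : Type*} [NormedAddCommGroup E] [NormedSpace ℂ E]

/-- Differentiation under the integral sign for a circle integral of a function that is
analytic in the variable and the parameter. -/
theorem hasFDerivAt_circleIntegral {F : ℂ × E → ℂ} {Ω : Set (ℂ × E)} (hΩ : IsOpen Ω)
    (hF : AnalyticOnNhd ℂ F Ω) {r : ℝ} (hr : 0 ≤ r) {e₀ : E}
    (h : ∀ s ∈ sphere (0 : ℂ) r, (s, e₀) ∈ Ω) :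
    HasFDerivAt (fun e => ∮ s in C(0, r), F (s, e))
      (∫ θ in 0..2 * Real.pi, deriv (circleMap 0 r) θ •
        (fderiv ℂ F (circleMap 0 r θ, e₀)).comp (ContinuousLinearMap.inr ℂ ℂ E)) e₀ := by
  have hcont : ContinuousOn (fun z => ‖fderiv ℂ F z‖) Ω := hF.fderiv.continuousOn.norm
  obtain ⟨C, hC⟩ := ((isCompact_sphere (0 : ℂ) r).image
    (f := fun s => (s, e₀)) (by fun_prop)).exists_bound_of_continuousOn
      (f := fun z => ‖fderiv ℂ F z‖) (hcont.mono (by rintro _ ⟨s, hs, rfl⟩; exact h s hs))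
  -- On this smaller neighbourhood of the circle the derivative is bounded by `C + 1`, which
  -- supplies the dominating function.
  have hΩ' : IsOpen (Ω ∩ (fun z => ‖fderiv ℂ F z‖) ⁻¹' Set.Iio (C + 1)) :=
    hcont.isOpen_inter_preimage hΩ isOpen_Iio
  have hev := eventually_forall_sphere hΩ' (r := r) (e₀ := e₀) fun s hs => by
    refine ⟨h s hs, ?_⟩
    have := hC _ ⟨s, hs, rfl⟩
    simp only [norm_norm] at this
    simp only [Set.mem_preimage, Set.mem_Iio]
    linarith
  have hmem : ∀ θ, circleMap 0 r θ ∈ sphere (0 : ℂ) r := fun θ => circleMap_mem_sphere _ hr _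
  have hslice : ∀ e, (∀ s ∈ sphere (0 : ℂ) r, (s, e) ∈ Ω) → Continuous fun θ =>
      deriv (circleMap 0 r) θ • F (circleMap 0 r θ, e) := fun e he => by
    simp only [deriv_circleMap]
    refine ((continuous_circleMap 0 r).mul continuous_const).smul ?_
    exact hF.continuousOn.comp_continuous (by fun_prop) fun θ => he _ (hmem θ)
  have hcurve : Continuous fun θ : ℝ => (circleMap 0 r θ, e₀) := by fun_prop
  refine intervalIntegral.hasFDerivAt_integral_of_dominated_of_fderiv_le
    (F' := fun e θ => deriv (circleMap 0 r) θ •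
        (fderiv ℂ F (circleMap 0 r θ, e)).comp (ContinuousLinearMap.inr ℂ ℂ E))
    (bound := fun _ => r * ((C + 1) * ‖ContinuousLinearMap.inr ℂ ℂ E‖)) hev ?_ ?_ ?_ ?_ ?_ ?_
  · filter_upwards [hev] with e he
    exact (hslice e fun s hs => (he s hs).1).aestronglyMeasurable
  · exact (hslice e₀ h).intervalIntegrable _ _
  · refine Continuous.aestronglyMeasurable ?_
    simp only [deriv_circleMap]
    refine ((continuous_circleMap 0 r).mul continuous_const).smul ?_
    exact (hF.fderiv.continuousOn.comp_continuous hcurve fun θ => h _ (hmem θ)).clm_comp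
      continuous_const
  · refine .of_forall fun θ _ e he => ?_
    have h1 : ‖deriv (circleMap 0 r) θ‖ = r := by simp [deriv_circleMap, abs_of_nonneg hr]
    rw [norm_smul, h1]
    gcongr
    refine (ContinuousLinearMap.opNorm_comp_le _ _).trans ?_
    gcongr
    exact (he _ (hmem θ)).2.le
  · exact intervalIntegrable_const
  · refine .of_forall fun θ _ e he => ?_
    have h1 := (hF _ (he _ (hmem θ)).1).differentiableAt.hasFDerivAt
    exact (h1.comp e (hasFDerivAt_prodMk_right (circleMap 0 r θ) e)).const_smul
      (deriv (circleMap 0 r) θ)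

theorem hasDerivAt_circleIntegral {F : ℂ × ℂ → ℂ} {Ω : Set (ℂ × ℂ)} (hΩ : IsOpen Ω)
    (hF : AnalyticOnNhd ℂ F Ω) {r : ℝ} (hr : 0 ≤ r) {τ : ℂ}
    (h : ∀ s ∈ sphere (0 : ℂ) r, (s, τ) ∈ Ω) :
    HasDerivAt (fun e => ∮ s in C(0, r), F (s, e))
      (∮ s in C(0, r), fderiv ℂ F (s, τ) (0, 1)) τ := by
  have h1 := (hasFDerivAt_circleIntegral hΩ hF hr h).hasDerivAt
  refine h1.congr_deriv ?_
  rw [ContinuousLinearMap.intervalIntegral_apply]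
  · simp [circleIntegral]
  · refine Continuous.intervalIntegrable ?_ _ _
    simp only [deriv_circleMap]
    refine ((continuous_circleMap 0 r).mul continuous_const).smul ?_
    exact (hF.fderiv.continuousOn.comp_continuous (by fun_prop)
      fun θ => h _ (circleMap_mem_sphere _ hr _)).clm_comp continuous_const

/-- The partial derivative of a function of two variables in the direction `dir`. -/
noncomputable def dirDeriv (dir : ℂ × ℂ) (F : ℂ × ℂ → ℂ) (z : ℂ × ℂ) : ℂ := fderiv ℂ F z dir

theorem AnalyticOnNhd.dirDeriv {F : ℂ × ℂ → ℂ} {Ω : Set (ℂ × ℂ)} (hF : AnalyticOnNhd ℂ F Ω)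
    (dir : ℂ × ℂ) : AnalyticOnNhd ℂ (dirDeriv dir F) Ω := fun z hz =>
  ((ContinuousLinearMap.apply ℂ ℂ dir).analyticAt _).comp (hF.fderiv z hz)

theorem AnalyticOnNhd.iterate_dirDeriv {F : ℂ × ℂ → ℂ} {Ω : Set (ℂ × ℂ)}
    (hF : AnalyticOnNhd ℂ F Ω) (dir : ℂ × ℂ) (n : ℕ) :
    AnalyticOnNhd ℂ ((_root_.dirDeriv dir)^[n] F) Ω := by
  induction n with
  | zero => exact hF
  | succ n ih => rw [Function.iterate_succ_apply']; exact ih.dirDeriv dir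

theorem iteratedDeriv_circleIntegral {F : ℂ × ℂ → ℂ} {Ω : Set (ℂ × ℂ)} (hΩ : IsOpen Ω)
    (hF : AnalyticOnNhd ℂ F Ω) {r : ℝ} (hr : 0 ≤ r) (m i : ℕ) {τ : ℂ}
    (h : ∀ s ∈ sphere (0 : ℂ) r, (s, τ) ∈ Ω) :
    iteratedDeriv i (fun τ => ∮ s in C(0, r), s ^ m * F (s, τ)) τ =
      ∮ s in C(0, r), s ^ m * (dirDeriv (0, 1))^[i] F (s, τ) := by
  induction i generalizing τ with
  | zero => simp
  | succ i ih =>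
    rw [iteratedDeriv_succ]
    have hi := hF.iterate_dirDeriv (0, 1) i
    have hev : iteratedDeriv i (fun τ => ∮ s in C(0, r), s ^ m * F (s, τ)) =ᶠ[𝓝 τ]
        fun τ => ∮ s in C(0, r), s ^ m * (dirDeriv (0, 1))^[i] F (s, τ) :=
      (eventually_forall_sphere hΩ h).mono fun σ hσ => ih hσ
    rw [hev.deriv_eq, (hasDerivAt_circleIntegral
      (F := fun z => z.1 ^ m * (dirDeriv (0, 1))^[i] F z) hΩ
      (fun z hz => (analyticAt_fst.pow m).mul (hi z hz)) hr h).deriv]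
    refine circleIntegral.integral_congr hr fun s hs => ?_
    have h1 : HasFDerivAt (fun z : ℂ × ℂ => z.1 ^ m) _ (s, τ) :=
      (hasFDerivAt_fst (𝕜 := ℂ) (p := (s, τ))).pow m
    have h2 := h1.mul (hi _ (h s hs)).differentiableAt.hasFDerivAt
    rw [show (fun z : ℂ × ℂ => z.1 ^ m * (dirDeriv (0, 1))^[i] F z) = (fun z : ℂ × ℂ => z.1 ^ m) *
      ((dirDeriv (0, 1))^[i] F) from rfl, h2.fderiv, Function.iterate_succ_apply']
    simp [dirDeriv]

/-- A closed contour leaves no boundary terms: each integration by parts trades one `s`-derivative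
for a factor `-m` and lowers the power of `s`. If `j > m`, a total derivative remains at the end. -/
theorem circleIntegral_pow_mul_iterate_dirDeriv {F : ℂ × ℂ → ℂ} {Ω : Set (ℂ × ℂ)}
    (hF : AnalyticOnNhd ℂ F Ω) {r : ℝ} (hr : 0 ≤ r) (m : ℕ) {j : ℕ} (hj : m ≤ j) {τ : ℂ}
    (h : ∀ s ∈ sphere (0 : ℂ) r, (s, τ) ∈ Ω) :
    (∮ s in C(0, r), s ^ m * (dirDeriv (1, 0))^[j] F (s, τ)) =
      if j = m then (-1) ^ m * (m.factorial : ℂ) * ∮ s in C(0, r), F (s, τ) else 0 := by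
  have hder : ∀ j, ∀ s ∈ sphere (0 : ℂ) r, HasDerivAt (fun s => (dirDeriv (1, 0))^[j] F (s, τ))
      ((dirDeriv (1, 0))^[j + 1] F (s, τ)) s := fun j s hs => by
    have h1 := ((hF.iterate_dirDeriv (1, 0) j) _ (h s hs)).differentiableAt.hasFDerivAt
    have h2 := (h1.comp s (hasFDerivAt_prodMk_left s τ)).hasDerivAt
    rw [Function.iterate_succ_apply']
    simpa [dirDeriv, Function.comp_def] using h2
  have hint : ∀ m j, CircleIntegrable (fun s => s ^ m * (dirDeriv (1, 0))^[j] F (s, τ)) 0 r :=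
    fun m j => ContinuousOn.circleIntegrable hr (ContinuousOn.mul (by fun_prop)
      fun s hs => (hder j s hs).continuousAt.continuousWithinAt)
  induction m generalizing j with
  | zero =>
    rcases j with _ | j
    · simp
    · simp only [pow_zero, one_mul]
      rw [if_neg (by omega)]
      exact circleIntegral.integral_eq_zero_of_hasDerivWithinAt hr
        fun s hs => (hder j s hs).hasDerivWithinAt
  | succ m ih =>
    obtain ⟨j, rfl⟩ : ∃ k, j = k + 1 := ⟨j - 1, by omega⟩
    have h0 : (∮ s in C(0, r), ((m + 1 : ℕ) * (s ^ m * (dirDeriv (1, 0))^[j] F (s, τ)) +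
        s ^ (m + 1) * (dirDeriv (1, 0))^[j + 1] F (s, τ))) = 0 :=
      circleIntegral.integral_eq_zero_of_hasDerivWithinAt hr fun s hs => by
        have := ((hasDerivAt_pow (m + 1) s).mul (hder j s hs)).hasDerivWithinAt
          (s := sphere (0 : ℂ) r)
        simpa [mul_assoc] using this
    rw [circleIntegral.integral_add (f := fun s => ((m + 1 : ℕ) : ℂ) * (s ^ m * (dirDeriv (1, 0))^[j] F (s, τ)))
        ((hint m j).const_smul (a := ((m + 1 : ℕ) : ℂ))) (hint _ _),
      circleIntegral.integral_const_mul, ih (by omega)] at h0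
    rw [eq_neg_of_add_eq_zero_right h0]
    by_cases hjm : j = m
    · simp only [hjm, if_true, Nat.factorial_succ]
      push_cast
      ring
    · simp [hjm]

end CircleIntegralParam

/-! ### Differential modules over polynomials in `s`, and the linear equation for the integral. -/

section EvalPolynomial
open Polynomial Topology

/-- The value at `z = (s, τ)` of a polynomial in `s`, whose coefficients are evaluated at `τ`
through `e τ`. -/
noncomputable def evalAt (e : ℂ → PolyXT →+* ℂ) (Q : PolyXT[X]) (z : ℂ × ℂ) : ℂ :=
  Q.eval₂ (e z.2) z.1

variable {e : ℂ → PolyXT →+* ℂ} {d : Derivation ℂ PolyXT PolyXT}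

theorem analyticAt_evalAt (he : ∀ P τ, HasDerivAt (fun σ => e σ P) (e τ (d P)) τ) (Q : PolyXT[X])
    (z : ℂ × ℂ) : AnalyticAt ℂ (evalAt e Q) z := by
  induction Q using Polynomial.induction_on' with
  | add p q hp hq =>
    have : evalAt e (p + q) = evalAt e p + evalAt e q := by
      ext z; simp [evalAt, eval₂_add]
    rw [this]
    exact hp.add hq
  | monomial n a =>
    have : evalAt e (monomial n a) = fun z => e z.2 a * z.1 ^ n := by
      ext z; simp [evalAt]
    rw [this]
    have h : AnalyticAt ℂ (fun σ => e σ a) z.2 :=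
      (show Differentiable ℂ fun σ => e σ a from fun τ => (he a τ).differentiableAt).analyticAt _
    exact (h.comp analyticAt_snd).mul (analyticAt_fst.pow n)

theorem dirDeriv_evalAt_left (he : ∀ P τ, HasDerivAt (fun σ => e σ P) (e τ (d P)) τ)
    (Q : PolyXT[X]) (z : ℂ × ℂ) :
    dirDeriv (1, 0) (evalAt e Q) z = evalAt e (derivative Q) z := by
  have h1 := (analyticAt_evalAt he Q z).differentiableAt.hasFDerivAt
  have h2 := (h1.comp z.1 (hasFDerivAt_prodMk_left z.1 z.2)).hasDerivAt
  have h3 : HasDerivAt (fun s => (Q.map (e z.2)).eval s) (evalAt e (derivative Q) z) z.1 := by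
    have := (Q.map (e z.2)).hasDerivAt z.1
    rwa [derivative_map, eval_map] at this
  have h4 : (evalAt e Q ∘ fun s => (s, z.2)) = fun s => (Q.map (e z.2)).eval s := by
    ext s; simp [evalAt, eval_map]
  rw [h4] at h2
  simpa [dirDeriv] using h2.unique h3

theorem dirDeriv_evalAt_right (he : ∀ P τ, HasDerivAt (fun σ => e σ P) (e τ (d P)) τ)
    (Q : PolyXT[X]) (z : ℂ × ℂ) :
    dirDeriv (0, 1) (evalAt e Q) z = evalAt e (coeffDer d Q) z := by
  have h1 := (analyticAt_evalAt he Q z).differentiableAt.hasFDerivAt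
  have h2 := (h1.comp z.2 (hasFDerivAt_prodMk_right z.1 z.2)).hasDerivAt
  have h3 : HasDerivAt (evalAt e Q ∘ fun τ => (z.1, τ)) (evalAt e (coeffDer d Q) z) z.2 := by
    clear h1 h2
    induction Q using Polynomial.induction_on' with
    | add p q hp hq =>
      simpa only [evalAt, Function.comp_def, coeffDer_add, eval₂_add] using hp.fun_add hq
    | monomial n a =>
      simpa only [evalAt, Function.comp_def, coeffDer_monomial, eval₂_monomial] using
        (he a z.2).mul_const (z.1 ^ n)
  simpa [dirDeriv] using h2.unique h3

variable {ι : Type*} [Fintype ι]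

/-- Differentiate `U ^ n F = v ⬝ Y` along `dir` and multiply by `U`. The system turns `U ∂Y` back
into a combination of `Y`, and the term from `∂(U ^ n)` is rewritten by the relation itself. -/
theorem evalAt_derivStep {dir : ℂ × ℂ} {D : PolyXT[X] → PolyXT[X]} {z : ℂ × ℂ}
    (hQ : ∀ Q, DifferentiableAt ℂ (evalAt e Q) z)
    (hD : ∀ Q, dirDeriv dir (evalAt e Q) z = evalAt e (D Q) z)
    {F : ℂ × ℂ → ℂ} {Y : ι → ℂ × ℂ → ℂ} (hF : DifferentiableAt ℂ F z)
    (hY : ∀ a, DifferentiableAt ℂ (Y a) z) {U : PolyXT[X]} {A : ι → ι → PolyXT[X]}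
    {v : ι → PolyXT[X]} {n : ℕ}
    (hYd : ∀ b, evalAt e U z * dirDeriv dir (Y b) z = ∑ a, evalAt e (A b a) z * Y a z)
    (heq : ∀ᶠ y in 𝓝 z, evalAt e U y ^ n * F y = ∑ a, evalAt e (v a) y * Y a y) :
    evalAt e U z ^ (n + 1) * dirDeriv dir F z =
      ∑ a, evalAt e (derivStep D U A n v a) z * Y a z := by
  have hline : ∀ {H : ℂ × ℂ → ℂ}, DifferentiableAt ℂ H z →
      HasDerivAt (fun τ : ℂ => H (z + τ • dir)) (dirDeriv dir H z) 0 :=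
    fun hH => hH.hasFDerivAt.hasLineDerivAt dir
  have h1 := ((hline (hQ U)).fun_pow n).fun_mul (hline hF)
  have h2 : HasDerivAt (fun τ : ℂ => ∑ a, evalAt e (v a) (z + τ • dir) * Y a (z + τ • dir)) _ 0 :=
    HasDerivAt.fun_sum fun a _ => (hline (hQ (v a))).fun_mul (hline (hY a))
  have htend : Filter.Tendsto (fun τ : ℂ => z + τ • dir) (𝓝 0) (𝓝 z) := by
    have : Continuous fun τ : ℂ => z + τ • dir := by fun_prop
    simpa using this.tendsto 0
  have h3 := h1.unique (h2.congr_of_eventuallyEq (htend.eventually heq))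
  simp only [zero_smul, add_zero, hD] at h3
  -- For `n = 0` the truncated exponent `n - 1` is harmless because of the factor `n`.
  have h4 : evalAt e U z * (n * evalAt e U z ^ (n - 1)) = n * evalAt e U z ^ n := by
    rcases n with _ | n
    · simp
    · simp [pow_succ]; ring
  have h5 := heq.self_of_nhds
  have h6 : ∑ a, evalAt e (v a) z * (evalAt e U z * dirDeriv dir (Y a) z) =
      ∑ a, (∑ b, evalAt e (v b) z * evalAt e (A b a) z) * Y a z := by
    simp only [hYd, Finset.mul_sum, Finset.sum_mul]
    rw [Finset.sum_comm]
    simp only [mul_assoc]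
  have h7 : ∀ a, evalAt e (derivStep D U A n v a) z = evalAt e U z * evalAt e (D (v a)) z +
      ∑ b, evalAt e (v b) z * evalAt e (A b a) z - n * evalAt e (D U) z * evalAt e (v a) z := by
    intro a
    simp [derivStep, evalAt, eval₂_sub, eval₂_add, eval₂_mul, eval₂_finsetSum]
  calc evalAt e U z ^ (n + 1) * dirDeriv dir F z
      = evalAt e U z * (n * evalAt e U z ^ (n - 1) * evalAt e (D U) z * F z +
          evalAt e U z ^ n * dirDeriv dir F z) -
          (evalAt e U z * (n * evalAt e U z ^ (n - 1))) * evalAt e (D U) z * F z := by ring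
    _ = ∑ a, evalAt e U z * (evalAt e (D (v a)) z * Y a z + evalAt e (v a) z * dirDeriv dir (Y a) z)
          - n * evalAt e (D U) z * (evalAt e U z ^ n * F z) := by
        rw [h3, h4, Finset.mul_sum]; ring
    _ = ∑ a, evalAt e (derivStep D U A n v a) z * Y a z := by
        rw [h5, Finset.mul_sum]
        simp only [h7, sub_mul, add_mul, mul_add, Finset.sum_sub_distrib, Finset.sum_add_distrib]
        rw [← h6]
        congr 1
        · congr 1
          · exact Finset.sum_congr rfl fun a _ => by ring
          · exact Finset.sum_congr rfl fun a _ => by ring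
        · exact Finset.sum_congr rfl fun a _ => by ring

theorem evalAt_derivVec (he : ∀ P τ, HasDerivAt (fun σ => e σ P) (e τ (d P)) τ)
    {Ω : Set (ℂ × ℂ)} (hΩ : IsOpen Ω) {G : ℂ × ℂ → ℂ} {Y : ι → ℂ × ℂ → ℂ}
    (hG : AnalyticOnNhd ℂ G Ω) (hY : ∀ a, AnalyticOnNhd ℂ (Y a) Ω) {U : PolyXT[X]}
    {A B : ι → ι → PolyXT[X]} {v : ι → PolyXT[X]}
    (hA : ∀ b, ∀ z ∈ Ω, evalAt e U z * dirDeriv (1, 0) (Y b) z = ∑ a, evalAt e (A b a) z * Y a z)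
    (hB : ∀ b, ∀ z ∈ Ω, evalAt e U z * dirDeriv (0, 1) (Y b) z = ∑ a, evalAt e (B b a) z * Y a z)
    (hv : ∀ z ∈ Ω, evalAt e U z * G z = ∑ a, evalAt e (v a) z * Y a z) (i j : ℕ) :
    ∀ z ∈ Ω, evalAt e U z ^ (i + j + 1) * (dirDeriv (0, 1))^[i] ((dirDeriv (1, 0))^[j] G) z =
      ∑ a, evalAt e (derivVec (coeffDer d) U A B v j i a) z * Y a z := by
  induction i with
  | zero =>
    simp only [Function.iterate_zero, id_eq, zero_add, derivVec]
    induction j with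
    | zero => simpa [derivVecLeft] using hv
    | succ j ih =>
      intro z hz
      rw [Function.iterate_succ_apply', derivVecLeft]
      exact evalAt_derivStep (fun Q => (analyticAt_evalAt he Q z).differentiableAt)
        (fun Q => dirDeriv_evalAt_left he Q z)
        ((hG.iterate_dirDeriv _ j) z hz).differentiableAt
        (fun a => (hY a z hz).differentiableAt) (fun b => hA b z hz)
        (Filter.eventually_of_mem (hΩ.mem_nhds hz) ih)
  | succ i ih =>
    intro z hz
    rw [Function.iterate_succ_apply', derivVec, show i + 1 + j + 1 = i + j + 1 + 1 by ring]
    exact evalAt_derivStep (fun Q => (analyticAt_evalAt he Q z).differentiableAt)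
      (fun Q => dirDeriv_evalAt_right he Q z)
      (((hG.iterate_dirDeriv _ j).iterate_dirDeriv _ i) z hz).differentiableAt
      (fun a => (hY a z hz).differentiableAt) (fun b => hB b z hz)
      (Filter.eventually_of_mem (hΩ.mem_nhds hz) ih)

open Metric in
/-- The integral over a circle of a function that lives in a finite-dimensional differential
module satisfies a linear differential equation in the parameter. -/
theorem exists_linearODE_circleIntegral (d : Derivation ℂ PolyXT PolyXT) (U : PolyXT[X])
    (A B : ι → ι → PolyXT[X]) (v : ι → PolyXT[X]) :
    ∃ (N : ℕ) (c : Fin N → PolyXT), c ≠ 0 ∧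
      ∀ (e : ℂ → PolyXT →+* ℂ), (∀ P τ, HasDerivAt (fun σ => e σ P) (e τ (d P)) τ) →
      ∀ (Ω : Set (ℂ × ℂ)) (G : ℂ × ℂ → ℂ) (Y : ι → ℂ × ℂ → ℂ) (r : ℝ) (τ : ℂ), IsOpen Ω → 0 ≤ r →
      (∀ s ∈ sphere (0 : ℂ) r, (s, τ) ∈ Ω) → U.map (e τ) ≠ 0 →
      AnalyticOnNhd ℂ G Ω → (∀ a, AnalyticOnNhd ℂ (Y a) Ω) →
      (∀ b, ∀ z ∈ Ω, evalAt e U z * dirDeriv (1, 0) (Y b) z = ∑ a, evalAt e (A b a) z * Y a z) →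
      (∀ b, ∀ z ∈ Ω, evalAt e U z * dirDeriv (0, 1) (Y b) z = ∑ a, evalAt e (B b a) z * Y a z) →
      (∀ z ∈ Ω, evalAt e U z * G z = ∑ a, evalAt e (v a) z * Y a z) →
      ∑ i : Fin N, e τ (c i) *
        iteratedDeriv (i + 1) (fun τ => ∮ s in C(0, r), G (s, τ)) τ = 0 := by
  classical
  -- The telescoper depends on the system alone, so `N` and `c` are fixed before the point, the
  -- circle and the functions: one equation serves everywhere.
  obtain ⟨N, c, hc, hrel⟩ :=
    exists_telescoper (coeffDer d) (natDegree_coeffDer_le d) U A B v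
  have hne : (Finset.univ.filter fun p => c p ≠ 0).Nonempty := by
    obtain ⟨p, hp⟩ := Function.ne_iff.1 hc
    exact ⟨p, by simpa using hp⟩
  -- With `m` the lowest `s`-order that occurs, multiplication by `s ^ m` and integration kill all
  -- higher orders and keep order `m` with the nonzero factor `(-1) ^ m * m!`.
  obtain ⟨p₀, hp₀, hmin⟩ := Finset.exists_min_image _ (fun p => p.2) hne
  set m := p₀.2
  refine ⟨N, fun i => c (i, m), fun h => ?_, ?_⟩
  · have := congrFun h p₀.1
    simp only [Finset.mem_filter, Finset.mem_univ, true_and] at hp₀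
    exact hp₀ this
  intro e he Ω G Y r τ hΩ hr hsph hU hG hY hA hB hv
  set g : Fin N × Fin N → ℂ × ℂ → ℂ := fun p =>
    (dirDeriv (0, 1))^[p.1 + 1] ((dirDeriv (1, 0))^[p.2] G) with hg
  have hga : ∀ p, AnalyticOnNhd ℂ (g p) Ω := fun p =>
    (hG.iterate_dirDeriv _ _).iterate_dirDeriv _ _
  have hzero : ∀ s, (s, τ) ∈ Ω → evalAt e U (s, τ) ≠ 0 → ∑ p, e τ (c p) * g p (s, τ) = 0 := by
    intro s hs hUs
    have h1 : evalAt e U (s, τ) ^ (2 * N + 1) * ∑ p, e τ (c p) * g p (s, τ) = 0 := by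
      calc _ = ∑ p : Fin N × Fin N, e τ (c p) * (evalAt e U (s, τ) ^ (2 * N - (p.1 + 1 + p.2)) *
            (evalAt e U (s, τ) ^ ((p.1 + 1 : ℕ) + (p.2 : ℕ) + 1) * g p (s, τ))) := by
            rw [Finset.mul_sum]
            refine Finset.sum_congr rfl fun p _ => ?_
            have : evalAt e U (s, τ) ^ (2 * N + 1) = evalAt e U (s, τ) ^ (2 * N - (p.1 + 1 + p.2)) *
                evalAt e U (s, τ) ^ ((p.1 + 1 : ℕ) + p.2 + 1) := by
              rw [← pow_add]
              congr 1
              have := p.1.2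
              have := p.2.2
              omega
            rw [this]; ring
        _ = ∑ a, evalAt e (∑ p : Fin N × Fin N, C (c p) * (U ^ (2 * N - (p.1 + 1 + p.2)) *
              derivVec (coeffDer d) U A B v p.2 (p.1 + 1) a)) (s, τ) * Y a (s, τ) := by
            have : ∀ p : Fin N × Fin N, evalAt e U (s, τ) ^ ((p.1 + 1 : ℕ) + (p.2 : ℕ) + 1) * g p (s, τ) = _ :=
              fun p => evalAt_derivVec he hΩ hG hY hA hB hv (p.1 + 1) p.2 (s, τ) hs
            simp only [this, Finset.mul_sum]
            rw [Finset.sum_comm]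
            refine Finset.sum_congr rfl fun a _ => ?_
            simp only [evalAt, eval₂_finsetSum, eval₂_mul, eval₂_C, eval₂_pow, Finset.sum_mul]
            exact Finset.sum_congr rfl fun p _ => by ring
        _ = 0 := by
            simp only [hrel]
            simp [evalAt]
    exact (mul_eq_zero.1 h1).resolve_left (pow_ne_zero _ hUs)
  -- Division by `U` fails at its roots only. These are finitely many in the slice at `τ`, and
  -- continuity covers them.
  have hzero' : ∀ s ∈ sphere (0 : ℂ) r, ∑ p, e τ (c p) * g p (s, τ) = 0 := by
    intro s hs
    by_contra hns
    have hcont : ContinuousAt (fun s => ∑ p, e τ (c p) * g p (s, τ)) s := by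
      refine tendsto_finsetSum _ fun p _ => ?_
      have h1 : ContinuousAt (fun s => (s, τ)) s := by fun_prop
      exact (ContinuousAt.comp (f := fun s => (s, τ)) (g := g p) ((hga p) _ (hsph s hs)).continuousAt
        h1).const_mul (e τ (c p))
    have hopen : ∀ᶠ s' in 𝓝 s, (s', τ) ∈ Ω :=
      (show Continuous fun s : ℂ => (s, τ) by fun_prop).continuousAt.eventually
        (hΩ.mem_nhds (hsph s hs))
    have hroot : ∀ᶠ s' in 𝓝 s, s' ∈ {x | (U.map (e τ)).IsRoot x} := by
      filter_upwards [hcont.eventually_ne hns, hopen] with s' h1 h2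
      by_contra h3
      refine h1 (hzero s' h2 ?_)
      rwa [evalAt, ← eval_map]
    exact hU (eq_zero_of_infinite_isRoot _ (infinite_of_mem_nhds s hroot))
  have hsum : ∑ p, e τ (c p) * ∮ s in C(0, r), s ^ (m : ℕ) * g p (s, τ) = 0 := by
    have hint : ∀ p, CircleIntegrable (fun s => e τ (c p) * (s ^ (m : ℕ) * g p (s, τ))) 0 r :=
      fun p => ContinuousOn.circleIntegrable hr (ContinuousOn.mul continuousOn_const
        (ContinuousOn.mul (by fun_prop) ((hga p).continuousOn.comp (by fun_prop) hsph)))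
    calc _ = ∮ s in C(0, r), ∑ p, e τ (c p) * (s ^ (m : ℕ) * g p (s, τ)) := by
          rw [circleIntegral.integral_fun_sum fun p _ => hint p]
          simp only [circleIntegral.integral_const_mul]
      _ = ∮ s in C(0, r), (0 : ℂ) := circleIntegral.integral_congr hr fun s hs => by
          rw [← mul_zero (s ^ (m : ℕ)), ← hzero' s hs, Finset.mul_sum]
          exact Finset.sum_congr rfl fun p _ => by ring
      _ = 0 := by simp [circleIntegral]
  have hterm : ∀ p, e τ (c p) * (∮ s in C(0, r), s ^ (m : ℕ) * g p (s, τ)) =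
      if p.2 = m then (-1) ^ (m : ℕ) * ((m : ℕ).factorial : ℂ) * (e τ (c (p.1, m)) *
        iteratedDeriv (p.1 + 1) (fun τ => ∮ s in C(0, r), G (s, τ)) τ) else 0 := by
    intro p
    by_cases hcp : c p = 0
    · rw [hcp, map_zero, zero_mul]
      split_ifs with h
      · rw [show (p.1, m) = p by rw [← h], hcp]; simp
      · rfl
    have hle : m ≤ p.2 := hmin p (by simpa using hcp)
    have hev : (fun τ => ∮ s in C(0, r), s ^ (m : ℕ) * (dirDeriv (1, 0))^[p.2] G (s, τ)) =ᶠ[𝓝 τ]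
        fun τ => (if (p.2 : ℕ) = m then (-1) ^ (m : ℕ) * ((m : ℕ).factorial : ℂ) else 0) *
          ∮ s in C(0, r), G (s, τ) := by
      filter_upwards [eventually_forall_sphere hΩ hsph] with σ hσ
      rw [circleIntegral_pow_mul_iterate_dirDeriv hG hr m hle hσ]
      split_ifs <;> simp
    rw [hg, ← iteratedDeriv_circleIntegral hΩ (hG.iterate_dirDeriv _ _) hr _ _ hsph,
      hev.iteratedDeriv_eq, iteratedDeriv_const_mul_field]
    by_cases h : p.2 = m
    · rw [if_pos h, if_pos (congrArg Fin.val h), show (p.1, m) = p by rw [← h]]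
      ring
    · rw [if_neg h, if_neg fun h' => h (Fin.ext h')]
      ring
  simp only [hterm] at hsum
  rw [Fintype.sum_prod_type] at hsum
  simp only [Finset.sum_ite_eq', Finset.mem_univ, if_true, ← Finset.mul_sum] at hsum
  exact (mul_eq_zero.1 hsum).resolve_left (mul_ne_zero (pow_ne_zero _ (by norm_num))
    (Nat.cast_ne_zero.2 (Nat.factorial_ne_zero _)))

end EvalPolynomial

/-! ### Holomorphic functions of two variables are analytic. -/

section Osgood
open Metric Topology Complex BoundedContinuousFunction

/-- Integration over the square `[0, 2π]²` of bounded continuous functions. -/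
noncomputable def squareIntegral : (ℝ × ℝ →ᵇ ℂ) →L[ℂ] ℂ :=
  LinearMap.mkContinuous
    { toFun := fun φ => ∫ θ in 0..2 * Real.pi, ∫ η in 0..2 * Real.pi, φ (θ, η)
      map_add' := fun φ ψ => by
        have h : ∀ (φ : ℝ × ℝ →ᵇ ℂ) θ, Continuous fun η => φ (θ, η) := fun φ θ => by fun_prop
        have h' : ∀ φ : ℝ × ℝ →ᵇ ℂ,
            Continuous fun θ => ∫ η in 0..2 * Real.pi, φ (θ, η) := fun φ =>
          intervalIntegral.continuous_parametric_intervalIntegral_of_continuous'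
            (f := fun θ η => φ (θ, η)) φ.continuous _ _
        simp only [BoundedContinuousFunction.add_apply]
        rw [← intervalIntegral.integral_add ((h' φ).intervalIntegrable _ _)
          ((h' ψ).intervalIntegrable _ _)]
        refine intervalIntegral.integral_congr fun θ _ => ?_
        exact intervalIntegral.integral_add ((h φ θ).intervalIntegrable _ _)
          ((h ψ θ).intervalIntegrable _ _)
      map_smul' := fun c φ => by simp }
    ((2 * Real.pi) * (2 * Real.pi)) fun φ => by
      have h1 : ∀ θ, ‖∫ η in 0..2 * Real.pi, φ (θ, η)‖ ≤ ‖φ‖ * |2 * Real.pi - 0| := fun θ =>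
        intervalIntegral.norm_integral_le_of_norm_le_const fun η _ => φ.norm_coe_le_norm _
      have h2 := intervalIntegral.norm_integral_le_of_norm_le_const (a := 0) (b := 2 * Real.pi)
        fun θ _ => h1 θ
      rw [sub_zero, abs_of_pos Real.two_pi_pos] at h2
      refine h2.trans (le_of_eq ?_)
      ring

theorem squareIntegral_apply (φ : ℝ × ℝ →ᵇ ℂ) :
    squareIntegral φ = ∫ θ in 0..2 * Real.pi, ∫ η in 0..2 * Real.pi, φ (θ, η) := rfl

/-- If `u` parametrizes a circle around `a` of radius `r`, then `x ↦ (u - x)⁻¹` is analytic near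
`a` as a map to the bounded continuous functions. -/
theorem exists_analyticAt_inv_sub (u : ℝ × ℝ → ℂ) (hu : Continuous u) {a : ℂ} {r : ℝ}
    (hr : 0 < r) (h : ∀ p, ‖u p - a‖ = r) :
    ∃ K : ℂ → (ℝ × ℝ →ᵇ ℂ), AnalyticAt ℂ K a ∧ ∀ x ∈ ball a r, ∀ p, K x p = (u p - x)⁻¹ := by
  have hbd : ∀ p, ‖u p‖ ≤ r + ‖a‖ := fun p => by
    rw [← h p]; simpa using norm_add_le (u p - a) a
  let f : ℝ × ℝ →ᵇ ℂ := ofNormedAddCommGroup u hu _ hbd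
  have hunit : ∀ x ∈ ball a r, ∃ v : (ℝ × ℝ →ᵇ ℂ)ˣ, (v : ℝ × ℝ →ᵇ ℂ) = f - x • 1 ∧
      ∀ p, (↑v⁻¹ : ℝ × ℝ →ᵇ ℂ) p = (u p - x)⁻¹ := by
    intro x hx
    rw [mem_ball, dist_eq_norm] at hx
    have hlow : ∀ p, r - ‖x - a‖ ≤ ‖u p - x‖ := fun p => by
      have := norm_sub_norm_le (u p - a) (x - a)
      rw [h p] at this
      simpa using this
    have hne : ∀ p, u p - x ≠ 0 := fun p => norm_pos_iff.1 (by linarith [hlow p])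
    let g : ℝ × ℝ →ᵇ ℂ := ofNormedAddCommGroup (fun p => (u p - x)⁻¹)
      ((hu.sub continuous_const).inv₀ hne) (r - ‖x - a‖)⁻¹ fun p => by
        rw [norm_inv]
        exact inv_anti₀ (by linarith) (hlow p)
    refine ⟨⟨f - x • 1, g, ?_, ?_⟩, rfl, fun p => rfl⟩
    · ext p
      simp [f, g, mul_inv_cancel₀ (hne p)]
    · ext p
      simp [f, g, inv_mul_cancel₀ (hne p)]
  -- Inversion is analytic at units of a Banach algebra, so the Cauchy kernel is analytic as a
  -- function-valued map, with no need to expand it by hand.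
  refine ⟨fun x => Ring.inverse (f - x • 1), ?_, fun x hx p => ?_⟩
  · obtain ⟨v, hv, -⟩ := hunit a (mem_ball_self hr)
    have h1 : AnalyticAt ℂ (fun x : ℂ => f - x • (1 : ℝ × ℝ →ᵇ ℂ)) a :=
      analyticAt_const.sub (analyticAt_id.smul analyticAt_const)
    have h2 := analyticAt_inverse (𝕜 := ℂ) v
    rw [hv] at h2
    exact AnalyticAt.comp (g := Ring.inverse) (f := fun x : ℂ => f - x • (1 : ℝ × ℝ →ᵇ ℂ)) h2 h1
  · obtain ⟨v, hv, hv'⟩ := hunit x hx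
    dsimp only
    rw [← hv, Ring.inverse_unit, hv']

/-- A holomorphic function of two variables is analytic. -/
theorem analyticOnNhd_of_differentiableOn {F : ℂ × ℂ → ℂ} {Ω : Set (ℂ × ℂ)} (hΩ : IsOpen Ω)
    (hF : DifferentiableOn ℂ F Ω) : AnalyticOnNhd ℂ F Ω := by
  rintro ⟨a, b⟩ hab
  obtain ⟨r, hr, hsub⟩ := Metric.nhds_basis_closedBall.mem_iff.1 (hΩ.mem_nhds hab)
  rw [← closedBall_prod_same] at hsub
  set ca : ℝ × ℝ → ℂ := fun p => circleMap a r p.1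
  set cb : ℝ × ℝ → ℂ := fun p => circleMap b r p.2
  have hca : Continuous ca := by fun_prop
  have hcb : Continuous cb := by fun_prop
  have hmem : ∀ p, (ca p, cb p) ∈ closedBall a r ×ˢ closedBall b r := fun p =>
    ⟨circleMap_mem_closedBall _ hr.le _, circleMap_mem_closedBall _ hr.le _⟩
  obtain ⟨Ka, hKa, hKa'⟩ := exists_analyticAt_inv_sub ca hca hr (a := a)
    fun p => by simp [ca, abs_of_pos hr]
  obtain ⟨Kb, hKb, hKb'⟩ := exists_analyticAt_inv_sub cb hcb hr (a := b)
    fun p => by simp [cb, abs_of_pos hr]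
  have hFcont : ContinuousOn F (closedBall a r ×ˢ closedBall b r) := hF.continuousOn.mono hsub
  obtain ⟨M, hM⟩ := ((isCompact_closedBall a r).prod
    (isCompact_closedBall b r)).exists_bound_of_continuousOn hFcont
  have hd1 : Continuous fun p : ℝ × ℝ => deriv (circleMap a r) p.1 := by
    simp only [deriv_circleMap]; fun_prop
  have hd2 : Continuous fun p : ℝ × ℝ => deriv (circleMap b r) p.2 := by
    simp only [deriv_circleMap]; fun_prop
  -- The iterated Cauchy formula becomes the continuous linear functional `squareIntegral` applied
  -- to `Φ * Ka x * Kb y`, which is analytic in `(x, y)`. The remaining steps identify it with `F`.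
  let Φ : ℝ × ℝ →ᵇ ℂ := ofNormedAddCommGroup
    (fun p => deriv (circleMap a r) p.1 * deriv (circleMap b r) p.2 * F (ca p, cb p))
    ((hd1.mul hd2).mul (hFcont.comp_continuous (by fun_prop) hmem)) (r * r * M) fun p => by
      rw [norm_mul, norm_mul]
      have h1 : ‖deriv (circleMap a r) p.1‖ = r := by simp [deriv_circleMap, abs_of_pos hr]
      have h2 : ‖deriv (circleMap b r) p.2‖ = r := by simp [deriv_circleMap, abs_of_pos hr]
      rw [h1, h2]
      gcongr
      exact hM _ (hmem p)
  have hana : AnalyticAt ℂ (fun z : ℂ × ℂ => (2 * Real.pi * I : ℂ)⁻¹ * ((2 * Real.pi * I : ℂ)⁻¹ *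
      squareIntegral (Φ * (Ka z.1 * Kb z.2)))) (a, b) := by
    have h1 : AnalyticAt ℂ (fun z : ℂ × ℂ => Ka z.1) (a, b) :=
      AnalyticAt.comp (g := Ka) (f := Prod.fst) (x := (a, b)) hKa analyticAt_fst
    have h2 : AnalyticAt ℂ (fun z : ℂ × ℂ => Kb z.2) (a, b) :=
      AnalyticAt.comp (g := Kb) (f := Prod.snd) (x := (a, b)) hKb analyticAt_snd
    have h3 : AnalyticAt ℂ (fun z : ℂ × ℂ => Φ * (Ka z.1 * Kb z.2)) (a, b) :=
      analyticAt_const.mul (h1.mul h2)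
    exact analyticAt_const.mul (analyticAt_const.mul
      ((squareIntegral.analyticAt _).fun_comp h3))
  refine hana.congr ?_
  have hball : ball a r ×ˢ ball b r ∈ 𝓝 (a, b) :=
    prod_mem_nhds (ball_mem_nhds a hr) (ball_mem_nhds b hr)
  filter_upwards [hball] with z hz
  have hslice1 : DifferentiableOn ℂ (fun s => F (s, z.2)) (closedBall a r) :=
    hF.comp (by fun_prop) fun s hs => hsub ⟨hs, ball_subset_closedBall hz.2⟩
  have hslice2 : ∀ s ∈ closedBall a r, DifferentiableOn ℂ (fun t => F (s, t)) (closedBall b r) :=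
    fun s hs => hF.comp (by fun_prop) fun t ht => hsub ⟨hs, ht⟩
  have e1 := hslice1.circleIntegral_sub_inv_smul hz.1
  have e2 : ∀ s ∈ closedBall a r, _ := fun s hs =>
    (hslice2 s hs).circleIntegral_sub_inv_smul hz.2
  have e3 : squareIntegral (Φ * (Ka z.1 * Kb z.2)) =
      ∮ s in C(a, r), (s - z.1)⁻¹ • ∮ t in C(b, r), (t - z.2)⁻¹ • F (s, t) := by
    rw [squareIntegral_apply, circleIntegral]
    refine intervalIntegral.integral_congr fun θ _ => ?_
    rw [circleIntegral, ← intervalIntegral.integral_smul, ← intervalIntegral.integral_smul]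
    refine intervalIntegral.integral_congr fun η _ => ?_
    simp only [mul_apply, hKa' _ hz.1, hKb' _ hz.2, smul_eq_mul]
    simp only [Φ, coe_ofNormedAddCommGroup, ca, cb]
    ring
  rw [e3]
  have e4 : (∮ s in C(a, r), (s - z.1)⁻¹ • ∮ t in C(b, r), (t - z.2)⁻¹ • F (s, t)) =
      ∮ s in C(a, r), (2 * Real.pi * I : ℂ) * ((s - z.1)⁻¹ • F (s, z.2)) :=
    circleIntegral.integral_congr hr.le fun s hs => by
      rw [e2 s (sphere_subset_closedBall hs)]
      simp only [smul_eq_mul]; ring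
  rw [e4, circleIntegral.integral_const_mul, e1]
  simp only [smul_eq_mul]
  field_simp

/-- A circle integral depends analytically on two complex parameters. -/
theorem analyticAt_circleIntegral {F : ℂ × ℂ × ℂ → ℂ} {Ω : Set (ℂ × ℂ × ℂ)} (hΩ : IsOpen Ω)
    (hF : AnalyticOnNhd ℂ F Ω) {r : ℝ} (hr : 0 ≤ r) {e₀ : ℂ × ℂ}
    (h : ∀ s ∈ sphere (0 : ℂ) r, (s, e₀) ∈ Ω) :
    AnalyticAt ℂ (fun e => ∮ s in C(0, r), F (s, e)) e₀ := by
  obtain ⟨V, hV, hVo, he₀⟩ := _root_.eventually_nhds_iff.1 (eventually_forall_sphere hΩ h)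
  exact analyticOnNhd_of_differentiableOn hVo (fun e he =>
    (hasFDerivAt_circleIntegral hΩ hF hr (hV e he)).differentiableAt.differentiableWithinAt) e₀ he₀

end Osgood

/-! ### Laurent parts as contour integrals. -/

section Laurent
open Metric Complex

theorem isOpen_openAnnulus (a b : ℝ) : IsOpen (openAnnulus a b) :=
  (isOpen_lt continuous_const continuous_norm).inter (isOpen_lt continuous_norm continuous_const)

theorem sphere_subset_openAnnulus {a b r : ℝ} (har : a < r) (hrb : r < b) :
    sphere (0 : ℂ) r ⊆ openAnnulus a b := fun s hs => by
  rw [mem_sphere_zero_iff_norm] at hs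
  exact ⟨by rwa [hs], by rwa [hs]⟩

theorem ne_zero_of_mem_openAnnulus {a b : ℝ} (ha : 0 ≤ a) {x : ℂ} (hx : x ∈ openAnnulus a b) :
    x ≠ 0 := norm_pos_iff.1 (ha.trans_lt hx.1)

variable {a b : ℝ}

theorem circleIntegral_eq_of_openAnnulus (ha : 0 ≤ a) {h : ℂ → ℂ}
    (hh : DifferentiableOn ℂ h (openAnnulus a b)) {r₁ r₂ : ℝ} (h₁ : a < r₁) (h₁₂ : r₁ ≤ r₂)
    (h₂ : r₂ < b) : (∮ s in C(0, r₂), h s) = ∮ s in C(0, r₁), h s := by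
  have hsub : closedBall (0 : ℂ) r₂ \ ball 0 r₁ ⊆ openAnnulus a b := fun s hs => by
    simp only [Set.mem_sdiff, mem_closedBall_zero_iff, mem_ball_zero_iff, not_lt] at hs
    exact ⟨by linarith [hs.2], by linarith [hs.1]⟩
  refine circleIntegral_eq_of_differentiable_on_annulus_off_countable (ha.trans_lt h₁) h₁₂
    Set.countable_empty (hh.continuousOn.mono hsub) fun z hz => ?_
  refine hh.differentiableAt ((isOpen_openAnnulus a b).mem_nhds (hsub ?_))
  exact ⟨ball_subset_closedBall hz.1.1, fun h => hz.1.2 (ball_subset_closedBall h)⟩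

theorem laurentCoeff_eq (ha : 0 ≤ a) {g : ℂ → ℂ}
    (hg : DifferentiableOn ℂ g (openAnnulus a b)) {r : ℝ} (har : a < r) (hrb : r < b) (j : ℤ) :
    laurentCoeff a b g j =
      (2 * (Real.pi : ℂ) * I)⁻¹ * ∮ s in C(0, r), s ^ (-j - 1) * g s := by
  have hd : DifferentiableOn ℂ (fun s => s ^ (-j - 1) * g s) (openAnnulus a b) :=
    DifferentiableOn.mul (fun s hs => (differentiableAt_zpow.2
      (Or.inl (ne_zero_of_mem_openAnnulus ha hs))).differentiableWithinAt) hg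
  rw [laurentCoeff]
  congr 1
  rcases le_total r ((a + b) / 2) with h | h
  · exact circleIntegral_eq_of_openAnnulus ha hd har h (by linarith)
  · exact (circleIntegral_eq_of_openAnnulus ha hd (by linarith) h hrb).symm

/-- For `‖x‖ < ‖s‖`, the geometric series `∑ x ^ (n + 1) / s ^ (n + 2)` sums to the kernel `x / (s *
(s - x))`. -/
theorem posPart_eq (ha : 0 ≤ a) {g : ℂ → ℂ}
    (hg : DifferentiableOn ℂ g (openAnnulus a b)) {r : ℝ} (har : a < r) (hrb : r < b) {x : ℂ}
    (hx : ‖x‖ < r) :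
    posPart a b g x = (2 * (Real.pi : ℂ) * I)⁻¹ * ∮ s in C(0, r), g s * (x / (s * (s - x))) := by
  have hr : 0 < r := ha.trans_lt har
  have hs0 : ∀ s ∈ sphere (0 : ℂ) r, s ≠ 0 := fun s hs =>
    ne_zero_of_mem_openAnnulus ha (sphere_subset_openAnnulus har hrb hs)
  have hci : CircleIntegrable (fun s => g s * x * s⁻¹) 0 r :=
    ContinuousOn.circleIntegrable hr.le
      (((hg.continuousOn.mono (sphere_subset_openAnnulus har hrb)).mul continuousOn_const).mul
        (continuousOn_id.inv₀ hs0))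
  have h := (hasSum_two_pi_I_cauchyPowerSeries_integral hci hx).mul_left (2 * (Real.pi : ℂ) * I)⁻¹
  unfold _root_.posPart
  rw [circleIntegral.integral_congr (g := fun s => (s - (0 + x))⁻¹ • (g s * x * s⁻¹)) hr.le,
    ← h.tsum_eq]
  · refine tsum_congr fun n => ?_
    rw [laurentCoeff_eq ha hg har hrb, mul_assoc]
    congr 1
    rw [mul_comm, ← circleIntegral.integral_const_mul]
    refine circleIntegral.integral_congr hr.le fun s hs => ?_
    have e1 : -((n : ℤ) + 1) - 1 = -((n + 2 : ℕ) : ℤ) := by push_cast; ring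
    have e2 : ((n : ℤ) + 1) = ((n + 1 : ℕ) : ℤ) := by push_cast; ring
    have := hs0 s hs
    simp only [sub_zero, smul_eq_mul]
    rw [e1, e2, zpow_neg, zpow_natCast, zpow_natCast, div_pow]
    field_simp
    ring
  · intro s hs
    simp only [zero_add, smul_eq_mul]
    rw [div_eq_mul_inv, mul_inv]
    ring

theorem hasSum_circleIntegral_geometric {g : ℂ → ℂ} {r : ℝ} (hr : 0 < r)
    (hg : CircleIntegrable g 0 r) {x : ℂ} (hx : r < ‖x‖) :
    HasSum (fun n : ℕ => ∮ s in C(0, r), (s / x) ^ n * (x⁻¹ * g s))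
      (∮ s in C(0, r), (x - s)⁻¹ * g s) := by
  have hx0 : x ≠ 0 := norm_pos_iff.1 (hr.trans hx)
  have hq : r / ‖x‖ ∈ Set.Ico (0 : ℝ) 1 :=
    ⟨by positivity, (div_lt_one (hr.trans hx)).2 hx⟩
  refine intervalIntegral.hasSum_integral_of_dominated_convergence
    (fun n θ => (r * ‖x‖⁻¹ * ‖g (circleMap 0 r θ)‖) * (r / ‖x‖) ^ n) (fun n => ?_) (fun n => ?_)
    ?_ ?_ ?_
  · simp only [deriv_circleMap, smul_eq_mul]
    refine MeasureTheory.AEStronglyMeasurable.mul ?_ (MeasureTheory.AEStronglyMeasurable.mul ?_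
      (MeasureTheory.AEStronglyMeasurable.mul ?_ hg.def'.1))
    all_goals exact Continuous.aestronglyMeasurable (by fun_prop)
  · refine .of_forall fun θ _ => le_of_eq ?_
    simp [deriv_circleMap, abs_of_pos hr]
    ring
  · refine .of_forall fun θ _ => ?_
    exact (summable_geometric_of_lt_one hq.1 hq.2).mul_left _
  · simp only [tsum_mul_left]
    exact (hg.norm.const_mul _).mul_const _
  · refine .of_forall fun θ _ => HasSum.const_smul _ ?_
    have hlt : ‖circleMap 0 r θ / x‖ < 1 := by simpa [abs_of_pos hr] using hq.2
    have := (hasSum_geometric_of_norm_lt_one hlt).mul_right (x⁻¹ * g (circleMap 0 r θ))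
    rwa [← mul_assoc, ← mul_inv, sub_mul, one_mul, div_mul_cancel₀ _ hx0] at this

/-- For `‖s‖ < ‖x‖`, the geometric series `∑ s ^ n / x ^ (n + 1)` sums to `-1 / (s - x)`. -/
theorem negPart_eq (ha : 0 ≤ a) {g : ℂ → ℂ}
    (hg : DifferentiableOn ℂ g (openAnnulus a b)) {r : ℝ} (har : a < r) (hrb : r < b) {x : ℂ}
    (hx : r < ‖x‖) :
    negPart a b g x = (2 * (Real.pi : ℂ) * I)⁻¹ * ∮ s in C(0, r), g s * (-1 / (s - x)) := by
  have hr : 0 < r := ha.trans_lt har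
  have hci : CircleIntegrable g 0 r := ContinuousOn.circleIntegrable hr.le
    (hg.continuousOn.mono (sphere_subset_openAnnulus har hrb))
  have h := (hasSum_circleIntegral_geometric hr hci hx).mul_left (2 * (Real.pi : ℂ) * I)⁻¹
  unfold _root_.negPart
  rw [circleIntegral.integral_congr (g := fun s => (x - s)⁻¹ * g s) hr.le, ← h.tsum_eq]
  · refine tsum_congr fun n => ?_
    rw [laurentCoeff_eq ha hg har hrb, mul_assoc]
    congr 1
    rw [mul_comm, ← circleIntegral.integral_const_mul]
    refine circleIntegral.integral_congr hr.le fun s hs => ?_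
    have e1 : - -((n : ℤ) + 1) - 1 = (n : ℤ) := by ring
    have e2 : ((n : ℤ) + 1) = ((n + 1 : ℕ) : ℤ) := by push_cast; ring
    rw [e1, e2, zpow_neg, zpow_natCast, zpow_natCast, div_pow]
    field_simp
    ring
  · intro s hs
    dsimp only
    rw [← neg_sub s x, inv_neg, div_eq_mul_inv]
    ring

theorem laurentCoeff_zero_eq (ha : 0 ≤ a) {g : ℂ → ℂ}
    (hg : DifferentiableOn ℂ g (openAnnulus a b)) {r : ℝ} (har : a < r) (hrb : r < b) :
    laurentCoeff a b g 0 = (2 * (Real.pi : ℂ) * I)⁻¹ * ∮ s in C(0, r), g s * (1 / s) := by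
  rw [laurentCoeff_eq ha hg har hrb]
  congr 1
  refine circleIntegral.integral_congr (ha.trans har.le) fun s hs => ?_
  simp [mul_comm]

theorem circleIntegral_sub_inv_of_lt {r : ℝ} (hr : 0 ≤ r) {x : ℂ} (hx : r < ‖x‖) :
    (∮ s in C(0, r), (s - x)⁻¹) = 0 := by
  have hne : ∀ s ∈ closedBall (0 : ℂ) r, s - x ≠ 0 := fun s hs h => by
    rw [mem_closedBall_zero_iff, sub_eq_zero.1 h] at hs
    linarith
  refine circleIntegral_eq_zero_of_differentiable_on_off_countable hr Set.countable_empty ?_ ?_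
  · exact (continuousOn_id.sub continuousOn_const).inv₀ hne
  · exact fun s hs => ((differentiableAt_id).sub_const x).inv (hne s (ball_subset_closedBall hs.1))

/-- The Laurent expansion of a holomorphic function on an annulus. -/
theorem negPart_add_laurentCoeff_add_posPart (ha : 0 ≤ a) {g : ℂ → ℂ}
    (hg : DifferentiableOn ℂ g (openAnnulus a b)) {x : ℂ} (hx : x ∈ openAnnulus a b) :
    negPart a b g x + laurentCoeff a b g 0 + posPart a b g x = g x := by
  obtain ⟨r₁, h₁, h₁'⟩ := exists_between hx.1
  obtain ⟨r₂, h₂, h₂'⟩ := exists_between hx.2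
  have hr₁ : 0 < r₁ := ha.trans_lt h₁
  have hr₂ : 0 < r₂ := by linarith
  rw [negPart_eq ha hg h₁ (by linarith) h₁', laurentCoeff_zero_eq ha hg (r := r₂)
    (by linarith) h₂', posPart_eq ha hg (by linarith) h₂' h₂]
  have hsub₁ := sphere_subset_openAnnulus (a := a) (b := b) h₁ (by linarith)
  have hsub₂ := sphere_subset_openAnnulus (a := a) (b := b) (r := r₂) (by linarith) h₂'
  have hne₁ : ∀ s ∈ sphere (0 : ℂ) r₁, s - x ≠ 0 := fun s hs h => by
    rw [mem_sphere_zero_iff_norm, sub_eq_zero.1 h] at hs; linarith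
  have hne₂ : ∀ s ∈ sphere (0 : ℂ) r₂, s - x ≠ 0 := fun s hs h => by
    rw [mem_sphere_zero_iff_norm, sub_eq_zero.1 h] at hs; linarith
  have hs0 : ∀ s ∈ sphere (0 : ℂ) r₂, s ≠ 0 := fun s hs =>
    ne_zero_of_mem_openAnnulus ha (hsub₂ hs)
  -- The difference quotient of `g` at `x` has a removable singularity there, so its integrals over
  -- the two circles agree. Written out, this is Cauchy's formula for the annulus.
  have hdsl := circleIntegral_eq_of_openAnnulus ha ((differentiableOn_dslope
    ((isOpen_openAnnulus a b).mem_nhds hx)).2 hg) h₁ (h₁'.trans h₂).le h₂'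
  have hsplit : ∀ r : ℝ, 0 < r → sphere (0 : ℂ) r ⊆ openAnnulus a b →
      (∀ s ∈ sphere (0 : ℂ) r, s - x ≠ 0) → (∮ s in C(0, r), dslope g x s) =
        (∮ s in C(0, r), (s - x)⁻¹ * g s) - (∮ s in C(0, r), (s - x)⁻¹) * g x := by
    intro r hr hsub hne
    have hinv : ContinuousOn (fun s : ℂ => (s - x)⁻¹) (sphere 0 r) :=
      (continuousOn_id.sub continuousOn_const).inv₀ hne
    rw [mul_comm, ← circleIntegral.integral_const_mul, ← circleIntegral.integral_sub
      (f := fun s => (s - x)⁻¹ * g s) (g := fun s => g x * (s - x)⁻¹)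
      (ContinuousOn.circleIntegrable hr.le (hinv.mul (hg.continuousOn.mono hsub)))
      (ContinuousOn.circleIntegrable hr.le (continuousOn_const.mul hinv))]
    refine circleIntegral.integral_congr hr.le fun s hs => ?_
    rw [dslope_of_ne _ (sub_ne_zero.1 (hne s hs)), slope_def_field]
    ring
  rw [hsplit r₂ hr₂ hsub₂ hne₂, hsplit r₁ hr₁ hsub₁ hne₁, circleIntegral_sub_inv_of_lt hr₁.le h₁',
    circleIntegral.integral_sub_inv_of_mem_ball (by simpa using h₂)] at hdsl
  have e1 : (∮ s in C(0, r₁), g s * (-1 / (s - x))) = -∮ s in C(0, r₁), (s - x)⁻¹ * g s := by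
    rw [neg_eq_neg_one_mul (∮ s in C(0, r₁), (s - x)⁻¹ * g s), ← circleIntegral.integral_const_mul]
    refine circleIntegral.integral_congr hr₁.le fun s hs => ?_
    ring
  have e2 : (∮ s in C(0, r₂), g s * (1 / s)) + (∮ s in C(0, r₂), g s * (x / (s * (s - x)))) =
      ∮ s in C(0, r₂), (s - x)⁻¹ * g s := by
    have hgc := hg.continuousOn.mono hsub₂
    rw [← circleIntegral.integral_add
      (f := fun s => g s * (1 / s)) (g := fun s => g s * (x / (s * (s - x))))
      (ContinuousOn.circleIntegrable hr₂.le (hgc.mul (continuousOn_const.div continuousOn_id hs0)))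
      (ContinuousOn.circleIntegrable hr₂.le (hgc.mul (continuousOn_const.div
        (continuousOn_id.mul (continuousOn_id.sub continuousOn_const))
        fun s hs => mul_ne_zero (hs0 s hs) (hne₂ s hs))))]
    refine circleIntegral.integral_congr hr₂.le fun s hs => ?_
    have := hs0 s hs
    have := hne₂ s hs
    field_simp
    ring
  rw [add_assoc, ← mul_add, e2, e1, ← mul_add]
  have hpi : (2 * (Real.pi : ℂ) * I) ≠ 0 := two_pi_I_ne_zero
  rw [inv_mul_eq_iff_eq_mul₀ hpi]
  linear_combination hdsl

end Laurent

/-! ### Logarithms on an annulus and the winding number. -/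

section LogOnAnnulus
open Metric Complex Topology

theorem exists_int_of_exp_eq_one {X : Type*} [TopologicalSpace X] {S : Set X}
    (hS : IsPreconnected S) {c : X → ℂ} (hc : ContinuousOn c S) (h : ∀ z ∈ S, exp (c z) = 1) :
    ∃ n : ℤ, ∀ z ∈ S, c z = n * (2 * Real.pi * I) := by
  have h' : ∀ z, ∃ n : ℤ, z ∈ S → c z = n * (2 * Real.pi * I) := fun z => by
    by_cases hz : z ∈ S
    · obtain ⟨n, hn⟩ := exp_eq_one_iff.1 (h z hz)
      exact ⟨n, fun _ => hn⟩
    · exact ⟨0, fun h => absurd h hz⟩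
  choose n hn using h'
  have hcont : ContinuousOn n S := by
    rw [Int.isClosedEmbedding_coe_real.isInducing.continuousOn_iff]
    have : ContinuousOn (fun z => (c z / (2 * Real.pi * I)).re) S :=
      continuous_re.comp_continuousOn (hc.div_const _)
    refine this.congr fun z hz => ?_
    simp only [Function.comp_apply]
    rw [hn z hz, mul_div_cancel_right₀ _ two_pi_I_ne_zero]
    simp
  rcases S.eq_empty_or_nonempty with rfl | ⟨z₀, hz₀⟩
  · exact ⟨0, by simp⟩
  · refine ⟨n z₀, fun z hz => ?_⟩
    rw [hn z hz, hS.constant hcont hz hz₀]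

/-- By continuity, `F` stays in one branch near `z`, where it equals `F z + log (H y / H z)`. -/
theorem differentiableAt_of_exp_eq {F H : ℂ → ℂ} {z : ℂ} (hF : ContinuousAt F z)
    (hH : DifferentiableAt ℂ H z) (h : ∀ᶠ y in 𝓝 z, exp (F y) = H y) : DifferentiableAt ℂ F z := by
  have hz : H z ≠ 0 := by rw [← h.self_of_nhds]; exact exp_ne_zero _
  have h1 : DifferentiableAt ℂ (fun y => F z + log (H y / H z)) z := by
    refine (DifferentiableAt.clog (hH.div_const _) ?_).const_add _
    rw [div_self hz]
    exact one_mem_slitPlane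
  refine h1.congr_of_eventuallyEq ?_
  have h2 : ∀ᶠ y in 𝓝 z, |(F y - F z).im| < Real.pi := by
    have : ContinuousAt (fun y => |(F y - F z).im|) z := by fun_prop
    exact this.eventually_lt continuousAt_const (by simpa using Real.pi_pos)
  filter_upwards [h, h2] with y hy1 hy2
  rw [abs_lt] at hy2
  rw [← hy1, ← h.self_of_nhds, ← exp_sub, log_exp hy2.1 hy2.2.le]
  ring

/-- The preimage of the annulus under `exp` is a convex strip, hence simply connected, and `h ∘ exp`
has a logarithm `F` there. Translation by `2πi` changes `F` by a constant, whose integer multiple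
`k` is the winding number. -/
theorem exists_log_comp_exp {a b : ℝ} (hab : a < b) (ha : 0 ≤ a) {h : ℂ → ℂ}
    (hh : DifferentiableOn ℂ h (openAnnulus a b)) (h0 : ∀ x ∈ openAnnulus a b, h x ≠ 0) :
    ∃ (F : ℂ → ℂ) (k : ℤ), ∀ z, exp z ∈ openAnnulus a b → DifferentiableAt ℂ F z ∧
      exp (F z) = h (exp z) ∧ F (z + 2 * Real.pi * I) = F z + k * (2 * Real.pi * I) := by
  set S : Set ℂ := exp ⁻¹' openAnnulus a b
  have hSo : IsOpen S := (isOpen_openAnnulus a b).preimage continuous_exp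
  have hSc : Convex ℝ S := by
    have : S = reLm ⁻¹' (Real.exp ⁻¹' Set.Ioo a b) := by
      ext z; simp [S, openAnnulus, norm_exp]
    rw [this]
    refine Convex.linear_preimage ?_ _
    exact (Set.OrdConnected.preimage_mono Set.ordConnected_Ioo Real.exp_monotone).convex
  have hSne : S.Nonempty := by
    refine ⟨Real.log ((a + b) / 2), ?_⟩
    have : 0 < (a + b) / 2 := by linarith
    simp only [S, Set.mem_preimage, openAnnulus, Set.mem_ofPred_eq, norm_exp, ofReal_re,
      Real.exp_log this]
    constructor <;> linarith
  have hsc : IsSimplyConnected S := by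
    have := hSc.contractibleSpace hSne
    exact SimplyConnectedSpace.ofContractible S
  have hcomp : ContinuousOn (fun z => h (exp z)) S :=
    hh.continuousOn.comp continuous_exp.continuousOn fun z hz => hz
  obtain ⟨F, hF, hFe⟩ := exists_continuousOn_eqOn_exp_comp hsc hSo hcomp (by
    rintro ⟨z, hz, hz0⟩; exact h0 _ hz hz0)
  have hper : ∀ z ∈ S, z + 2 * Real.pi * I ∈ S := fun z hz => by
    simpa [S, exp_periodic z] using hz
  obtain ⟨k, hk⟩ := exists_int_of_exp_eq_one hSc.isPreconnected
    (c := fun z => F (z + 2 * Real.pi * I) - F z)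
    ((hF.comp (by fun_prop) hper).sub hF) fun z hz => by
      have h1 := hFe hz
      have h2 := hFe (hper z hz)
      simp only [Function.comp_apply] at h1 h2
      rw [exp_sub, h1, h2, exp_periodic z, div_self (h0 _ hz)]
  refine ⟨F, k, fun z hz => ⟨?_, hFe hz, ?_⟩⟩
  · refine differentiableAt_of_exp_eq (hF.continuousAt (hSo.mem_nhds hz)) ?_
      (Filter.eventually_of_mem (hSo.mem_nhds hz) fun y hy => hFe hy)
    exact (hh.differentiableAt ((isOpen_openAnnulus a b).mem_nhds hz)).comp z differentiableAt_exp
  · linear_combination hk z hz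

/-- The function `F z - k z` has period `2πi`, so it descends through `exp` to the annulus. -/
theorem exists_eq_zpow_mul_exp {a b : ℝ} (hab : a < b) (ha : 0 ≤ a) {h : ℂ → ℂ}
    (hh : DifferentiableOn ℂ h (openAnnulus a b)) (h0 : ∀ x ∈ openAnnulus a b, h x ≠ 0) :
    ∃ (k : ℤ) (L : ℂ → ℂ), DifferentiableOn ℂ L (openAnnulus a b) ∧
      ∀ x ∈ openAnnulus a b, h x = x ^ k * exp (L x) := by
  classical
  obtain ⟨F, k, hF⟩ := exists_log_comp_exp hab ha hh h0
  -- The value `0` off the strip makes the periodicity hold on all of `ℂ`.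
  set G : ℂ → ℂ := fun z => if exp z ∈ openAnnulus a b then F z - k * z else 0
  have hGper : Function.Periodic G (2 * Real.pi * I) := fun z => by
    simp only [G, exp_periodic z]
    split_ifs with hz
    · rw [(hF z hz).2.2]; ring
    · rfl
  have hG : ∀ z, exp z ∈ openAnnulus a b → DifferentiableAt ℂ G z := fun z hz => by
    have h1 : DifferentiableAt ℂ (fun z => F z - k * z) z :=
      (hF z hz).1.sub (differentiableAt_id.const_mul _)
    refine h1.congr_of_eventuallyEq ?_
    filter_upwards [((isOpen_openAnnulus a b).preimage continuous_exp).mem_nhds hz] with y hy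
    exact if_pos hy
  have hGlog : ∀ x z, x ≠ 0 → exp z = x → G (log x) = G z := fun x z hx hz => by
    obtain ⟨n, hn⟩ := exp_eq_exp_iff_exists_int.1 ((exp_log hx).trans hz.symm)
    rw [hn]
    exact hGper.int_mul n z
  refine ⟨k, fun x => G (log x), fun x hx => ?_, fun x hx => ?_⟩
  · have hx0 := ne_zero_of_mem_openAnnulus ha hx
    refine DifferentiableAt.differentiableWithinAt ?_
    by_cases hs : x ∈ slitPlane
    · exact DifferentiableAt.comp x (hG _ (by rwa [exp_log hx0])) (differentiableAt_id.clog hs)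
    -- On the cut of `log`, the branch `log (-y) + πi` is used; periodicity of `G` makes the choice
    -- immaterial.
    · have hs' : -x ∈ slitPlane := by
        rw [mem_slitPlane_iff] at hs ⊢
        push Not at hs
        left
        have : x.re ≠ 0 := fun h => hx0 (Complex.ext h hs.2)
        simpa using lt_of_le_of_ne hs.1 this
      have hexp : ∀ y : ℂ, y ≠ 0 → exp (log (-y) + Real.pi * I) = y := fun y hy => by
        rw [exp_add, exp_log (neg_ne_zero.2 hy), exp_pi_mul_I]; ring
      have h1 : DifferentiableAt ℂ (fun y => G (log (-y) + Real.pi * I)) x :=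
        DifferentiableAt.comp x (g := G) (f := fun y => log (-y) + Real.pi * I)
          (hG _ (by rwa [hexp x hx0]))
          ((DifferentiableAt.clog differentiableAt_id.neg hs').add_const _)
      refine h1.congr_of_eventuallyEq ?_
      filter_upwards [eventually_ne_nhds hx0] with y hy
      exact hGlog y _ hy (hexp y hy)
  · have hx0 := ne_zero_of_mem_openAnnulus ha hx
    have hx' : exp (log x) ∈ openAnnulus a b := by rwa [exp_log hx0]
    simp only [G, if_pos hx']
    rw [exp_sub, (hF _ hx').2.1, exp_log hx0, exp_int_mul, exp_log hx0,
      mul_div_cancel₀ _ (zpow_ne_zero _ hx0)]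

/-- Logarithmic differentiation makes `L' - L` a primitive of `(k - k') / s` on the circle, whose
integral `2πi (k - k')` must therefore vanish. -/
theorem zpow_eq_of_eq_zpow_mul_exp {r : ℝ} (hr : 0 < r) {k k' : ℤ} {L L' : ℂ → ℂ}
    (hL : ∀ s ∈ sphere (0 : ℂ) r, DifferentiableAt ℂ L s)
    (hL' : ∀ s ∈ sphere (0 : ℂ) r, DifferentiableAt ℂ L' s)
    (h : ∀ s ∈ sphere (0 : ℂ) r, ∀ᶠ y in 𝓝 s, y ^ k * exp (L y) = y ^ k' * exp (L' y)) :
    k = k' := by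
  have hs0 : ∀ s ∈ sphere (0 : ℂ) r, s ≠ 0 := fun s hs h => by
    rw [mem_sphere_zero_iff_norm, h, norm_zero] at hs
    exact hr.ne hs
  have hder : ∀ s ∈ sphere (0 : ℂ) r,
      HasDerivWithinAt (fun y => L' y - L y) ((k - k') * s⁻¹) (sphere 0 r) s := fun s hs => by
    have hs1 := hs0 s hs
    have h1 := (hasDerivAt_zpow k s (.inl hs1)).mul (hL s hs).hasDerivAt.cexp
    have h2 := (hasDerivAt_zpow k' s (.inl hs1)).mul (hL' s hs).hasDerivAt.cexp
    have h3 := h1.unique (h2.congr_of_eventuallyEq (h s hs))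
    have h4 := (h s hs).self_of_nhds
    have h5 : s ^ k * exp (L s) ≠ 0 := mul_ne_zero (zpow_ne_zero _ hs1) (exp_ne_zero _)
    rw [zpow_sub_one₀ hs1, zpow_sub_one₀ hs1] at h3
    have h6 : deriv L' s - deriv L s = (k - k') * s⁻¹ := by
      refine mul_left_cancel₀ h5 ?_
      linear_combination (deriv L' s + k' * s⁻¹) * h4 - h3
    rw [← h6]
    exact ((hL' s hs).hasDerivAt.sub (hL s hs).hasDerivAt).hasDerivWithinAt
  have h0 := circleIntegral.integral_eq_zero_of_hasDerivWithinAt hr.le hder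
  have h1 := circleIntegral.integral_sub_center_inv (0 : ℂ) hr.ne'
  simp only [sub_zero] at h1
  rw [circleIntegral.integral_const_mul, h1, mul_eq_zero] at h0
  have := h0.resolve_right two_pi_I_ne_zero
  exact_mod_cast sub_eq_zero.1 this

/-- A logarithm of `F(·, t₀)` on an open set extends to a logarithm of `F` that is analytic in
both variables. -/
theorem exists_local_log {D : Set (ℂ × ℂ)} (hD : IsOpen D) {F : ℂ × ℂ → ℂ}
    (hF : AnalyticOnNhd ℂ F D) {t₀ : ℂ} {V : Set ℂ} (hV : IsOpen V)
    (hVD : ∀ s ∈ V, (s, t₀) ∈ D) {L : ℂ → ℂ} (hL : DifferentiableOn ℂ L V)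
    (hFL : ∀ s ∈ V, F (s, t₀) = exp (L s)) (hF0 : ∀ z ∈ D, F z ≠ 0) :
    ∃ (Ω : Set (ℂ × ℂ)) (M : ℂ × ℂ → ℂ), IsOpen Ω ∧ Ω ⊆ D ∧ AnalyticOnNhd ℂ M Ω ∧
      (∀ s ∈ V, (s, t₀) ∈ Ω) ∧ ∀ z ∈ Ω, F z = exp (M z) := by
  set D' : Set (ℂ × ℂ) := D ∩ Prod.fst ⁻¹' V
  have hD' : IsOpen D' := hD.inter (hV.preimage continuous_fst)
  have hproj : ∀ z : ℂ × ℂ, AnalyticAt ℂ (fun z : ℂ × ℂ => (z.1, t₀)) z := fun z =>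
    analyticAt_fst.prod analyticAt_const
  have hQ : AnalyticOnNhd ℂ (fun z => F z / F (z.1, t₀)) D' := fun z hz =>
    (hF z hz.1).div (AnalyticAt.comp (g := F) (f := fun z : ℂ × ℂ => (z.1, t₀)) (x := z)
      (hF (z.1, t₀) (hVD _ hz.2)) (hproj z)) (hF0 _ (hVD _ hz.2))
  -- Near `t = t₀` the ratio `F (s, t) / F (s, t₀)` is close to `1`, so its principal logarithm can
  -- be added to `L s`.
  refine ⟨D' ∩ (fun z => F z / F (z.1, t₀)) ⁻¹' slitPlane,
    fun z => L z.1 + log (F z / F (z.1, t₀)), hQ.continuousOn.isOpen_inter_preimage hD'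
    isOpen_slitPlane, fun z hz => hz.1.1, fun z hz => ?_, fun s hs => ⟨⟨hVD s hs, hs⟩, ?_⟩,
    fun z hz => ?_⟩
  · exact ((hL.analyticAt (hV.mem_nhds hz.1.2)).fun_comp analyticAt_fst).add ((hQ z hz.1).clog hz.2)
  · simp [div_self (hF0 _ (hVD s hs))]
  · have h1 := hF0 _ (hVD _ hz.1.2)
    dsimp only
    rw [exp_add, exp_log (div_ne_zero (hF0 z hz.1.1) h1), ← hFL _ hz.1.2, mul_div_cancel₀ _ h1]

end LogOnAnnulus

/-! ### Existence and uniqueness of `k`. -/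

section WindingNumber
open Metric Complex Topology

variable {T : Set ℂ} {ρ R : ℂ → ℝ}

theorem isOpen_annularDomain (hT : IsOpen T) (hρ : ContinuousOn ρ T) (hR : ContinuousOn R T) :
    IsOpen (annularDomain T ρ R) := by
  rw [isOpen_iff_mem_nhds]
  rintro ⟨x, t⟩ ⟨ht, hx1, hx2⟩
  have hT' := hT.mem_nhds ht
  have h1 : ContinuousAt (fun z : ℂ × ℂ => ρ z.2) (x, t) :=
    ContinuousAt.comp (f := Prod.snd) (g := ρ) (x := (x, t)) (hρ.continuousAt hT') continuousAt_snd
  have h2 : ContinuousAt (fun z : ℂ × ℂ => R z.2) (x, t) :=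
    ContinuousAt.comp (f := Prod.snd) (g := R) (x := (x, t)) (hR.continuousAt hT') continuousAt_snd
  have h3 : ContinuousAt (fun z : ℂ × ℂ => ‖z.1‖) (x, t) := by fun_prop
  filter_upwards [continuousAt_snd.eventually hT', h1.eventually_lt h3 hx1,
    h3.eventually_lt h2 hx2] with z hz1 hz2 hz3
  exact ⟨hz1, hz2, hz3⟩

theorem existsUnique_isLogOn (hT_open : IsOpen T) (hT_conn : IsConnected T)
    (hT_zero : (0 : ℂ) ∉ T) (hρ_cont : ContinuousOn ρ T) (hR_cont : ContinuousOn R T)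
    (hρ_nonneg : ∀ t ∈ T, 0 ≤ ρ t) (hρR : ∀ t ∈ T, ρ t < R t) {f : ℂ → ℂ → ℂ}
    (hf : AnalyticOnNhd ℂ (fun z : ℂ × ℂ => f z.1 z.2) (annularDomain T ρ R))
    (hf_ne : ∀ x t : ℂ, (x, t) ∈ annularDomain T ρ R → f x t ≠ 0) :
    ∃! k : ℤ, ∀ i : ℤ, ∃ L : ℂ → ℂ → ℂ, IsLogOn T ρ R f k i L := by
  set D := annularDomain T ρ R
  have hD : IsOpen D := isOpen_annularDomain hT_open hρ_cont hR_cont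
  have hslice : ∀ t ∈ T, DifferentiableOn ℂ (fun x => f x t) (openAnnulus (ρ t) (R t)) :=
    fun t ht x hx => (AnalyticAt.comp (g := fun z : ℂ × ℂ => f z.1 z.2) (f := fun x => (x, t))
      (x := x) (hf (x, t) ⟨ht, hx⟩)
      (analyticAt_id.prod analyticAt_const)).differentiableAt.differentiableWithinAt
  have hex : ∀ t, ∃ (k : ℤ) (L : ℂ → ℂ), t ∈ T → DifferentiableOn ℂ L (openAnnulus (ρ t) (R t)) ∧
      ∀ x ∈ openAnnulus (ρ t) (R t), f x t = x ^ k * exp (L x) := fun t => by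
    by_cases ht : t ∈ T
    · obtain ⟨k, L, h⟩ := exists_eq_zpow_mul_exp (hρR t ht) (hρ_nonneg t ht) (hslice t ht)
        fun x hx => hf_ne x t ⟨ht, hx⟩
      exact ⟨k, L, fun _ => h⟩
    · exact ⟨0, 0, fun h => absurd h ht⟩
  choose k L hL using hex
  have hmid : ∀ t ∈ T, ρ t < (ρ t + R t) / 2 ∧ (ρ t + R t) / 2 < R t := fun t ht => by
    have := hρR t ht
    constructor <;> linarith
  -- A logarithm at `t₀` extends to a neighbourhood of a whole circle. Comparison there with the
  -- logarithm at `t` forces equal exponents.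
  have hconst : ∀ t₀ ∈ T, ∀ᶠ t in 𝓝 t₀, k t = k t₀ := by
    intro t₀ ht₀
    obtain ⟨hr1, hr2⟩ := hmid t₀ ht₀
    set r := (ρ t₀ + R t₀) / 2
    have hr : 0 < r := (hρ_nonneg t₀ ht₀).trans_lt hr1
    have hD0 : ∀ z ∈ D, z.1 ≠ 0 := fun z hz => ne_zero_of_mem_openAnnulus (hρ_nonneg _ hz.1) hz.2
    obtain ⟨Ω, M, hΩ, hΩD, hM, hV, hFM⟩ := exists_local_log hD
      (F := fun z => z.1 ^ (-k t₀) * f z.1 z.2)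
      (fun z hz => (analyticAt_fst.zpow (hD0 z hz)).mul (hf z hz))
      (isOpen_openAnnulus (ρ t₀) (R t₀)) (fun s hs => ⟨ht₀, hs⟩) (hL t₀ ht₀).1
      (fun s hs => by
        have := ne_zero_of_mem_openAnnulus (hρ_nonneg _ ht₀) hs
        dsimp only
        rw [(hL t₀ ht₀).2 s hs, ← mul_assoc, ← zpow_add₀ this]
        simp)
      (fun z hz => mul_ne_zero (zpow_ne_zero _ (hD0 z hz)) (hf_ne _ _ hz))
    filter_upwards [eventually_forall_sphere hΩ (r := r) fun s hs =>
      hV s (sphere_subset_openAnnulus hr1 hr2 hs)] with t ht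
    have hpt : (r : ℂ) ∈ sphere (0 : ℂ) r := by simp [abs_of_pos hr]
    have htT : t ∈ T := (hΩD (ht _ hpt)).1
    refine zpow_eq_of_eq_zpow_mul_exp hr (L := L t) (L' := fun s => M (s, t)) (fun s hs => ?_)
      (fun s hs => ?_) fun s hs => ?_
    · exact (hL t htT).1.differentiableAt
        ((isOpen_openAnnulus _ _).mem_nhds (hΩD (ht s hs)).2)
    · exact (AnalyticAt.comp (g := M) (f := fun s => (s, t)) (x := s) (hM _ (ht s hs))
        (analyticAt_id.prod analyticAt_const)).differentiableAt
    · have : ∀ᶠ y in 𝓝 s, (y, t) ∈ Ω :=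
        (show Continuous fun y : ℂ => (y, t) by fun_prop).continuousAt.eventually
          (hΩ.mem_nhds (ht s hs))
      filter_upwards [this] with y hy
      rw [← (hL t htT).2 y (hΩD hy).2, ← hFM _ hy, ← mul_assoc, ← zpow_add₀ (hD0 _ (hΩD hy))]
      simp
  obtain ⟨t₁, ht₁⟩ := hT_conn.nonempty
  have hcont : ContinuousOn k T := fun t ht =>
    ((continuousAt_const (y := k t)).congr
      ((hconst t ht).mono fun s hs => hs.symm)).continuousWithinAt
  have hk : ∀ t ∈ T, k t = k t₁ := fun t ht => hT_conn.isPreconnected.constant hcont ht ht₁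
  -- At each fixed `t` the factor `t ^ i` is a constant, absorbed by any logarithm of `t`; no
  -- continuity in `t` is required.
  refine ⟨k t₁, fun i => ⟨fun x t => L t x - i * log t, fun t ht => ⟨?_, fun x hx => ?_⟩⟩, ?_⟩
  · exact (hL t ht).1.sub_const _
  · have ht0 : t ≠ 0 := fun h => hT_zero (h ▸ ht)
    rw [(hL t ht).2 x hx, hk t ht, exp_sub, exp_int_mul, exp_log ht0]
    have := zpow_ne_zero i ht0
    field_simp
  · intro k' hk'
    obtain ⟨L', hL'⟩ := hk' 0
    obtain ⟨h1, h2⟩ := hL' t₁ ht₁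
    obtain ⟨hr1, hr2⟩ := hmid t₁ ht₁
    have hV := isOpen_openAnnulus (ρ t₁) (R t₁)
    have hsub := sphere_subset_openAnnulus hr1 hr2
    refine zpow_eq_of_eq_zpow_mul_exp ((hρ_nonneg t₁ ht₁).trans_lt hr1)
      (fun s hs => h1.differentiableAt (hV.mem_nhds (hsub hs)))
      (fun s hs => (hL t₁ ht₁).1.differentiableAt (hV.mem_nhds (hsub hs))) fun s hs => ?_
    filter_upwards [hV.mem_nhds (hsub hs)] with y hy
    rw [← (hL t₁ ht₁).2 y hy, h2 y hy]
    simp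

end WindingNumber

/-! ### Quadratic functions and their logarithmic derivatives. -/

section QuadraticForm
open Topology

theorem hasDerivAt_polyVal_left (t : ℂ) (P : PolyXT) (x : ℂ) :
    HasDerivAt (fun σ => polyVal σ t P) (polyVal x t (MvPolynomial.pderiv 0 P)) x := by
  induction P using MvPolynomial.induction_on with
  | C a => simpa [polyVal] using hasDerivAt_const x a
  | add p q hp hq => simpa using hp.fun_add hq
  | mul_X p n hp =>
    have hX : HasDerivAt (fun σ => polyVal σ t (MvPolynomial.X n))
        (polyVal x t (MvPolynomial.pderiv 0 (MvPolynomial.X n))) x := by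
      fin_cases n
      · simpa [polyVal] using hasDerivAt_id' x
      · simpa [polyVal, MvPolynomial.pderiv_X_of_ne] using hasDerivAt_const x t
    simp only [map_mul]
    refine (hp.fun_mul hX).congr_deriv ?_
    rw [Derivation.leibniz, smul_eq_mul, smul_eq_mul, map_add, map_mul, map_mul]
    ring

theorem hasDerivAt_polyVal_right (x : ℂ) (P : PolyXT) (t : ℂ) :
    HasDerivAt (fun σ => polyVal x σ P) (polyVal x t (MvPolynomial.pderiv 1 P)) t := by
  induction P using MvPolynomial.induction_on with
  | C a => simpa [polyVal] using hasDerivAt_const t a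
  | add p q hp hq => simpa using hp.fun_add hq
  | mul_X p n hp =>
    have hX : HasDerivAt (fun σ => polyVal x σ (MvPolynomial.X n))
        (polyVal x t (MvPolynomial.pderiv 1 (MvPolynomial.X n))) t := by
      fin_cases n
      · simpa [polyVal, MvPolynomial.pderiv_X_of_ne] using hasDerivAt_const t x
      · simpa [polyVal] using hasDerivAt_id' t
    simp only [map_mul]
    refine (hp.fun_mul hX).congr_deriv ?_
    rw [Derivation.leibniz, smul_eq_mul, smul_eq_mul, map_add, map_mul, map_mul]
    ring

theorem analyticAt_polyVal (P : PolyXT) (z : ℂ × ℂ) :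
    AnalyticAt ℂ (fun z : ℂ × ℂ => polyVal z.1 z.2 P) z := by
  induction P using MvPolynomial.induction_on with
  | C a => simpa [polyVal] using analyticAt_const
  | add p q hp hq => simpa using hp.fun_add hq
  | mul_X p n hp =>
    have hX : AnalyticAt ℂ (fun z : ℂ × ℂ => polyVal z.1 z.2 (MvPolynomial.X n)) z := by
      fin_cases n
      · simpa [polyVal] using analyticAt_fst
      · simpa [polyVal] using analyticAt_snd
    simpa using hp.fun_mul hX

theorem dirDeriv_polyVal_left (P : PolyXT) (z : ℂ × ℂ) :
    dirDeriv (1, 0) (fun z => polyVal z.1 z.2 P) z = polyVal z.1 z.2 (MvPolynomial.pderiv 0 P) := by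
  have h1 := (analyticAt_polyVal P z).differentiableAt.hasFDerivAt
  have h2 := (HasFDerivAt.comp (f := fun s => (s, z.2)) z.1 h1
    (hasFDerivAt_prodMk_left z.1 z.2)).hasDerivAt
  simpa [dirDeriv] using h2.unique (hasDerivAt_polyVal_left z.2 P z.1)

theorem dirDeriv_polyVal_right (P : PolyXT) (z : ℂ × ℂ) :
    dirDeriv (0, 1) (fun z => polyVal z.1 z.2 P) z = polyVal z.1 z.2 (MvPolynomial.pderiv 1 P) := by
  have h1 := (analyticAt_polyVal P z).differentiableAt.hasFDerivAt
  have h2 := (HasFDerivAt.comp (f := fun s => (z.1, s)) z.2 h1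
    (hasFDerivAt_prodMk_right z.1 z.2)).hasDerivAt
  simpa [dirDeriv] using h2.unique (hasDerivAt_polyVal_right z.1 P z.2)

/-- A neighbourhood contains a product of two infinite sets, and a polynomial vanishing on such a
grid is zero. -/
theorem eq_zero_of_forall_polyVal_eq_zero {P : PolyXT} {z : ℂ × ℂ}
    (h : ∀ᶠ y in 𝓝 z, polyVal y.1 y.2 P = 0) : P = 0 := by
  rw [nhds_prod_eq] at h
  obtain ⟨u, hu, v, hv, huv⟩ := Filter.eventually_prod_iff.1 h
  refine MvPolynomial.funext_set ![{x | u x}, {x | v x}] (fun i => ?_) fun y hy => ?_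
  · fin_cases i
    · exact infinite_of_mem_nhds _ hu
    · exact infinite_of_mem_nhds _ hv
  · have h0 := hy 0 (Set.mem_univ _)
    have h1 := hy 1 (Set.mem_univ _)
    have e : y = ![y 0, y 1] := by ext i; fin_cases i <;> rfl
    rw [map_zero, e]
    exact huv h0 h1

/-- A continuous function that vanishes off the zeros of a nonzero polynomial is zero. -/
theorem eq_zero_of_continuousOn {D : Set (ℂ × ℂ)} (hD : IsOpen D) {g : ℂ × ℂ → ℂ}
    (hg : ContinuousOn g D) {P : PolyXT} (hP : P ≠ 0)
    (h : ∀ z ∈ D, polyVal z.1 z.2 P ≠ 0 → g z = 0) : ∀ z ∈ D, g z = 0 := by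
  intro z hz
  by_contra hgz
  refine hP (eq_zero_of_forall_polyVal_eq_zero (z := z) ?_)
  filter_upwards [(hg.continuousAt (hD.mem_nhds hz)).eventually_ne hgz, hD.mem_nhds hz] with y h1 h2
  by_contra h3
  exact h1 (h y h2 h3)

/-- On `D` one has `w ^ 2 = δ` and `A F = V w + B`, with `δ`, `A` and the norm
`B ^ 2 - V ^ 2 δ` nonzero. -/
def IsQuadraticOn (D : Set (ℂ × ℂ)) (F w : ℂ × ℂ → ℂ) (δ A V B : PolyXT) : Prop :=
  AnalyticOnNhd ℂ w D ∧ δ ≠ 0 ∧ A ≠ 0 ∧ B ^ 2 - V ^ 2 * δ ≠ 0 ∧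
  ∀ z ∈ D, w z ^ 2 = polyVal z.1 z.2 δ ∧
    polyVal z.1 z.2 A * F z = polyVal z.1 z.2 V * w z + polyVal z.1 z.2 B

/-- With `A` the product of the three denominators, `A f - B` is a polynomial multiple of the square
root, so its square is a polynomial. Continuity carries the identity across the poles. -/
theorem IsBranchOn.exists_sq_eq {p q Δ : RatXT} {D : Set (ℂ × ℂ)} (hD : IsOpen D)
    {f : ℂ → ℂ → ℂ} (hf : IsBranchOn p q Δ D f) :
    ∃ δ A B : PolyXT, A ≠ 0 ∧ ∀ z ∈ D,
      (polyVal z.1 z.2 A * f z.1 z.2 - polyVal z.1 z.2 B) ^ 2 = polyVal z.1 z.2 δ := by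
  set np := IsFractionRing.num PolyXT p
  set nq := IsFractionRing.num PolyXT q
  set nd := IsFractionRing.num PolyXT Δ
  set dp : PolyXT := ↑(IsFractionRing.den PolyXT p) with hdp
  set dq : PolyXT := ↑(IsFractionRing.den PolyXT q) with hdq
  set dd : PolyXT := ↑(IsFractionRing.den PolyXT Δ) with hdd
  have hA : dp * dq * dd ≠ 0 := mul_ne_zero (mul_ne_zero (nonZeroDivisors.coe_ne_zero _)
    (nonZeroDivisors.coe_ne_zero _)) (nonZeroDivisors.coe_ne_zero _)
  refine ⟨nq ^ 2 * dp ^ 2 * dd * nd, dp * dq * dd, np * dq * dd, hA, fun z hz => ?_⟩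
  rw [← sub_eq_zero]
  refine eq_zero_of_continuousOn hD (g := fun z => (polyVal z.1 z.2 (dp * dq * dd) * f z.1 z.2 -
    polyVal z.1 z.2 (np * dq * dd)) ^ 2 - polyVal z.1 z.2 (nq ^ 2 * dp ^ 2 * dd * nd)) ?_ hA ?_ z hz
  · exact fun y hy => (((((analyticAt_polyVal _ y).mul (hf.1 y hy)).sub
      (analyticAt_polyVal _ y)).pow 2).sub (analyticAt_polyVal _ y)).continuousAt.continuousWithinAt
  · rintro ⟨x, t⟩ hy hne
    simp only [map_mul, mul_ne_zero_iff] at hne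
    obtain ⟨⟨h1, h2⟩, h3⟩ := hne
    obtain ⟨w, hw, hfw⟩ := hf.2 x t hy h1 h2 h3
    simp only [RatXT.val] at hw hfw
    rw [← hdd] at hw
    rw [← hdp, ← hdq] at hfw
    rw [eq_div_iff h3] at hw
    simp only [map_mul, map_pow]
    rw [hfw]
    have e : polyVal x t dp * polyVal x t dq * polyVal x t dd *
        (polyVal x t np / polyVal x t dp + polyVal x t nq / polyVal x t dq * w) -
        polyVal x t np * polyVal x t dq * polyVal x t dd =
        polyVal x t nq * polyVal x t dp * polyVal x t dd * w := by
      field_simp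
      ring
    change (polyVal x t dp * polyVal x t dq * polyVal x t dd *
        (polyVal x t np / polyVal x t dp + polyVal x t nq / polyVal x t dq * w) -
        polyVal x t np * polyVal x t dq * polyVal x t dd) ^ 2 - _ = 0
    rw [e, ← hw]
    ring

/-- Generically `w = A f - B` serves as the square root: it is analytic because `f` is, so no branch
has to be chosen. If `δ` or the norm vanishes, `f` is rational. -/
theorem IsBranchOn.exists_isQuadraticOn {p q Δ : RatXT} {D : Set (ℂ × ℂ)} (hD : IsOpen D)
    (hDne : D.Nonempty) {f : ℂ → ℂ → ℂ} (hf : IsBranchOn p q Δ D f)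
    (hf_ne : ∀ x t : ℂ, (x, t) ∈ D → f x t ≠ 0) :
    ∃ w δ A V B, IsQuadraticOn D (fun z => f z.1 z.2) w δ A V B := by
  obtain ⟨δ, A, B, hA, hsq⟩ := hf.exists_sq_eq hD
  obtain ⟨z₀, hz₀⟩ := hDne
  -- A rational `f` fits the form with `w = δ = 1` and `V = 0`; the norm is `B' ^ 2`, nonzero since
  -- `f` has no zeros.
  have hrat : ∀ B' : PolyXT, (∀ z ∈ D, polyVal z.1 z.2 A * f z.1 z.2 = polyVal z.1 z.2 B') →
      ∃ w δ A V B, IsQuadraticOn D (fun z => f z.1 z.2) w δ A V B := fun B' hB' => by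
    refine ⟨fun _ => 1, 1, A, 0, B', fun _ _ => analyticAt_const, one_ne_zero, hA, ?_,
      fun z hz => ⟨by simp, by simpa using hB' z hz⟩⟩
    rintro h
    have hB0 : B' = 0 := by simpa using h
    refine hA (eq_zero_of_forall_polyVal_eq_zero (z := z₀) ?_)
    filter_upwards [hD.mem_nhds hz₀] with z hz
    have := hB' z hz
    rw [hB0, map_zero] at this
    exact (mul_eq_zero.1 this).resolve_right (hf_ne _ _ hz)
  by_cases hδ : δ = 0
  · refine hrat B fun z hz => ?_
    have := hsq z hz
    rw [hδ, map_zero] at this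
    exact sub_eq_zero.1 (pow_eq_zero_iff two_ne_zero |>.1 this)
  by_cases hC : B ^ 2 - (1 : PolyXT) ^ 2 * δ = 0
  -- Here `δ = B ^ 2`, so `(A f - B) ^ 2 = B ^ 2` factors as `A f (A f - 2 B) = 0`, and `f` has no
  -- zeros.
  · refine hrat (2 * B) ?_
    have key : ∀ z ∈ D, polyVal z.1 z.2 A * f z.1 z.2 - polyVal z.1 z.2 (2 * B) = 0 := by
      refine eq_zero_of_continuousOn hD (fun y hy => (((analyticAt_polyVal _ y).mul
        (hf.1 y hy)).sub (analyticAt_polyVal _ y)).continuousAt.continuousWithinAt) hA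
        fun z hz hAz => ?_
      have h1 := hsq z hz
      have h2 : δ = B ^ 2 := by linear_combination -hC
      rw [h2, map_pow] at h1
      refine mul_left_cancel₀ (mul_ne_zero hAz (hf_ne _ _ hz)) ?_
      simp only [map_mul, map_ofNat]
      linear_combination h1
    exact fun z hz => sub_eq_zero.1 (key z hz)
  · refine ⟨fun z => polyVal z.1 z.2 A * f z.1 z.2 - polyVal z.1 z.2 B, δ, A, 1, B,
      fun z hz => ((analyticAt_polyVal _ z).mul (hf.1 z hz)).sub (analyticAt_polyVal _ z), hδ, hA,
      hC, fun z hz => ⟨hsq z hz, by simp⟩⟩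

theorem IsQuadraticOn.zpow_mul {D : Set (ℂ × ℂ)} {F w : ℂ × ℂ → ℂ} {δ A V B : PolyXT}
    (h : IsQuadraticOn D F w δ A V B) (hx : ∀ z ∈ D, z.1 ≠ 0) (ht : ∀ z ∈ D, z.2 ≠ 0)
    (k i : ℤ) {G : ℂ × ℂ → ℂ} (hG : ∀ z ∈ D, F z = z.1 ^ k * z.2 ^ i * G z) :
    ∃ A' V' B', IsQuadraticOn D G w δ A' V' B' := by
  obtain ⟨hw, hδ, hA, hC, hrel⟩ := h
  -- Positive powers multiply the left side and negative powers the right side, so everything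
  -- remains polynomial.
  set m₁ : PolyXT := MvPolynomial.X 0 ^ k.toNat * MvPolynomial.X 1 ^ i.toNat
  set m₂ : PolyXT := MvPolynomial.X 0 ^ (-k).toNat * MvPolynomial.X 1 ^ (-i).toNat
  have hm₁ : m₁ ≠ 0 := mul_ne_zero (pow_ne_zero _ (MvPolynomial.X_ne_zero _))
    (pow_ne_zero _ (MvPolynomial.X_ne_zero _))
  have hm₂ : m₂ ≠ 0 := mul_ne_zero (pow_ne_zero _ (MvPolynomial.X_ne_zero _))
    (pow_ne_zero _ (MvPolynomial.X_ne_zero _))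
  refine ⟨m₁ * A, m₂ * V, m₂ * B, hw, hδ, mul_ne_zero hm₁ hA, ?_, fun z hz =>
    ⟨(hrel z hz).1, ?_⟩⟩
  · rw [show (m₂ * B) ^ 2 - (m₂ * V) ^ 2 * δ = m₂ ^ 2 * (B ^ 2 - V ^ 2 * δ) by ring]
    exact mul_ne_zero (pow_ne_zero _ hm₂) hC
  · have hpow : ∀ (y : ℂ) (j : ℤ), y ≠ 0 → y ^ j * y ^ (-j).toNat = y ^ j.toNat := fun y j hy => by
      rw [← zpow_natCast, ← zpow_natCast, ← zpow_add₀ hy]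
      congr 1
      omega
    have h1 := hpow z.1 k (hx z hz)
    have h2 := hpow z.2 i (ht z hz)
    have h3 := (hrel z hz).2
    rw [hG z hz] at h3
    have e1 : polyVal z.1 z.2 m₁ = z.1 ^ k.toNat * z.2 ^ i.toNat := by simp [m₁, polyVal]
    have e2 : polyVal z.1 z.2 m₂ = z.1 ^ (-k).toNat * z.2 ^ (-i).toNat := by simp [m₂, polyVal]
    simp only [map_mul, e1, e2, ← h1, ← h2]
    linear_combination z.1 ^ (-k).toNat * z.2 ^ (-i).toNat * h3

theorem IsQuadraticOn.dirDeriv_sqrt {Ω : Set (ℂ × ℂ)} (hΩ : IsOpen Ω) {F w : ℂ × ℂ → ℂ}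
    {δ A V B δ' : PolyXT} (h : IsQuadraticOn Ω F w δ A V B) {z : ℂ × ℂ} (hz : z ∈ Ω)
    {dir : ℂ × ℂ} (hδ' : dirDeriv dir (fun z => polyVal z.1 z.2 δ) z = polyVal z.1 z.2 δ') :
    2 * polyVal z.1 z.2 δ * dirDeriv dir w z = polyVal z.1 z.2 δ' * w z := by
  obtain ⟨hw, -, -, -, hrel⟩ := h
  have h1 : (fun z => w z ^ 2) =ᶠ[𝓝 z] fun z => polyVal z.1 z.2 δ :=
    Filter.eventually_of_mem (hΩ.mem_nhds hz) fun y hy => (hrel y hy).1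
  have h2 := (hw z hz).differentiableAt.hasFDerivAt.pow 2
  have h3 : dirDeriv dir (fun z => w z ^ 2) z = 2 * w z * dirDeriv dir w z := by
    rw [dirDeriv, h2.fderiv]
    simp [dirDeriv]
  rw [dirDeriv, h1.fderiv_eq] at h3
  rw [dirDeriv] at hδ'
  rw [hδ'] at h3
  rw [← (hrel z hz).1, h3]
  ring

/-- The derivatives of a logarithm of `F` lie in the module spanned by `1` and `w`. -/
theorem IsQuadraticOn.dirDeriv_log {Ω : Set (ℂ × ℂ)} (hΩ : IsOpen Ω) {F w M : ℂ × ℂ → ℂ}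
    {δ A V B δ' A' V' B' : PolyXT} (h : IsQuadraticOn Ω F w δ A V B)
    (hM : AnalyticOnNhd ℂ M Ω) (hFM : ∀ z ∈ Ω, F z = Complex.exp (M z))
    {z : ℂ × ℂ} (hz : z ∈ Ω) {dir : ℂ × ℂ}
    (hδ' : dirDeriv dir (fun z => polyVal z.1 z.2 δ) z = polyVal z.1 z.2 δ')
    (hA' : dirDeriv dir (fun z => polyVal z.1 z.2 A) z = polyVal z.1 z.2 A')
    (hV' : dirDeriv dir (fun z => polyVal z.1 z.2 V) z = polyVal z.1 z.2 V')
    (hB' : dirDeriv dir (fun z => polyVal z.1 z.2 B) z = polyVal z.1 z.2 B') :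
    polyVal z.1 z.2 (2 * δ * A * (B ^ 2 - V ^ 2 * δ)) * dirDeriv dir M z =
      polyVal z.1 z.2 ((A * (2 * δ * V' + V * δ') - 2 * δ * A' * V) * B -
        (2 * δ * A * B' - 2 * δ * A' * B) * V) * w z +
      polyVal z.1 z.2 ((2 * δ * A * B' - 2 * δ * A' * B) * B -
        (A * (2 * δ * V' + V * δ') - 2 * δ * A' * V) * V * δ) := by
  have hsqrt := h.dirDeriv_sqrt hΩ hz hδ'
  obtain ⟨hw, -, -, -, hrel⟩ := h
  have hP : ∀ P : PolyXT, HasFDerivAt (fun z : ℂ × ℂ => polyVal z.1 z.2 P) _ z := fun P =>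
    (analyticAt_polyVal P z).differentiableAt.hasFDerivAt
  have h1 : (fun z => polyVal z.1 z.2 A * Complex.exp (M z)) =ᶠ[𝓝 z]
      fun z => polyVal z.1 z.2 V * w z + polyVal z.1 z.2 B :=
    Filter.eventually_of_mem (hΩ.mem_nhds hz) fun y hy => by
      dsimp only; rw [← hFM y hy]; exact (hrel y hy).2
  have h2 := (hP A).fun_mul (hM z hz).differentiableAt.hasFDerivAt.cexp
  have h3 := ((hP V).fun_mul (hw z hz).differentiableAt.hasFDerivAt).fun_add (hP B)
  have h4 := congrArg (fun ℓ => ℓ dir) (h2.unique (h3.congr_of_eventuallyEq h1))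
  have h5 := (hrel z hz).2
  have h6 := (hrel z hz).1
  rw [hFM z hz] at h5
  simp only [dirDeriv] at *
  simp only [add_apply, smul_apply, smul_eq_mul,
    hA', hV', hB'] at h4
  simp only [map_mul, map_sub, map_add, map_pow, map_ofNat]
  generalize polyVal z.1 z.2 δ = δ₀ at *
  generalize polyVal z.1 z.2 A = A₀ at *
  generalize polyVal z.1 z.2 V = V₀ at *
  generalize polyVal z.1 z.2 B = B₀ at *
  generalize polyVal z.1 z.2 δ' = δ₁ at *
  generalize polyVal z.1 z.2 A' = A₁ at *
  generalize polyVal z.1 z.2 V' = V₁ at *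
  generalize polyVal z.1 z.2 B' = B₁ at *
  generalize fderiv ℂ M z dir = M₁ at *
  generalize fderiv ℂ w z dir = w₁ at *
  generalize w z = w₀ at *
  generalize Complex.exp (M z) = E₀ at *
  have h7 : 2 * δ₀ * A₀ * (V₀ * w₀ + B₀) * M₁ =
      (A₀ * (2 * δ₀ * V₁ + V₀ * δ₁) - 2 * δ₀ * A₁ * V₀) * w₀ +
        (2 * δ₀ * A₀ * B₁ - 2 * δ₀ * A₁ * B₀) := by
    linear_combination 2 * δ₀ * A₀ * h4 + A₀ * V₀ * hsqrt - (2 * δ₀ * A₀ * M₁ + 2 * δ₀ * A₁) * h5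
  -- Multiplication by the conjugate `B - V w` turns the factor `V w + B` in front of `∂M` into the
  -- norm `B ^ 2 - V ^ 2 δ`.
  linear_combination (B₀ - V₀ * w₀) * h7 + (2 * δ₀ * A₀ * V₀ ^ 2 * M₁ - (A₀ * (2 * δ₀ * V₁ + V₀ * δ₁) - 2 * δ₀ * A₁ * V₀) * V₀) * h6

end QuadraticForm

/-! ### Differential equations for exponentials of kernel integrals. -/

section KernelIntegral
open Topology Metric Polynomial

/-- The polynomial `P(s, t)` in `ℂ[x, t][s]`. -/
noncomputable def substX : PolyXT →+* PolyXT[X] :=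
  MvPolynomial.eval₂Hom ((C : PolyXT →+* PolyXT[X]).comp MvPolynomial.C)
    ![X, C (MvPolynomial.X 1)]

/-- After the substitution the integration variable takes the place of `x`, so the coefficient
variable `x` is free to be the parameter of the kernel. -/
theorem eval₂_substX (x t s : ℂ) (P : PolyXT) :
    (substX P).eval₂ (polyVal x t) s = polyVal s t P := by
  have : (eval₂RingHom (polyVal x t) s).comp substX = polyVal s t := by
    refine MvPolynomial.ringHom_ext (fun a => ?_) fun i => ?_
    · simp [substX, polyVal]
    · fin_cases i <;> simp [substX, polyVal]
  rw [← this]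
  rfl

theorem substX_ne_zero {P : PolyXT} (hP : P ≠ 0) : substX P ≠ 0 := fun h =>
  hP (eq_zero_of_forall_polyVal_eq_zero (z := 0) (.of_forall fun z => by
    rw [← eval₂_substX 0, h, eval₂_zero]))

/-- The polynomial `s (s - x)`. -/
noncomputable def kernelDen : PolyXT[X] := X * (X - C (MvPolynomial.X 0))

theorem kernelDen_ne_zero : kernelDen ≠ 0 := mul_ne_zero X_ne_zero (X_sub_C_ne_zero _)

theorem eval₂_kernelDen (x t s : ℂ) : kernelDen.eval₂ (polyVal x t) s = s * (s - x) := by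
  simp [kernelDen, polyVal, eval₂_mul, eval₂_sub]

/-- The matrix of a derivation on `(1, w, log F)`, where `w' = a w` and `(log F)' = E w + H`. -/
noncomputable def logMatrix (a E H : PolyXT) : Fin 3 → Fin 3 → PolyXT[X] :=
  ![0, ![0, substX a * kernelDen, 0], ![substX H * kernelDen, substX E * kernelDen, 0]]

theorem eval₂_expODE_circleIntegral {e : PolyXT →+* ℂ} {h : ℂ → ℂ} {I : ℂ → ℂ} {τ a : ℂ} {N : ℕ}
    {c : Fin N → PolyXT} (hI : AnalyticAt ℂ I τ) (hh : h =ᶠ[𝓝 τ] fun σ => Complex.exp (a * I σ))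
    (hODE : ∑ i : Fin N, e (c i) * iteratedDeriv (i + 1) I τ = 0) :
    MvPolynomial.eval₂ e (fun n => iteratedDeriv n h τ) (expODE PolyXT c) = 0 := by
  refine eval₂_expODE e (analyticAt_const.mul hI) hh c ?_
  calc _ = a * ∑ i : Fin N, e (c i) * iteratedDeriv (i + 1) I τ := by
        rw [Finset.mul_sum]
        refine Finset.sum_congr rfl fun i _ => ?_
        rw [show ((fun _ => a) * I : ℂ → ℂ) = fun σ => a * I σ from rfl,
          iteratedDeriv_const_mul_field]
        ring
    _ = 0 := by rw [hODE, mul_zero]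

theorem dirDeriv_comp_fst {H : ℂ × ℂ → ℂ} {t : ℂ} {z : ℂ × ℂ} (v : ℂ × ℂ)
    (hH : DifferentiableAt ℂ H (z.1, t)) :
    dirDeriv v (fun z => H (z.1, t)) z = dirDeriv (v.1, 0) H (z.1, t) := by
  have h1 : HasFDerivAt (fun z : ℂ × ℂ => (z.1, t)) _ z :=
    (hasFDerivAt_fst (𝕜 := ℂ) (p := z)).prodMk (hasFDerivAt_const t z)
  have h2 := HasFDerivAt.comp (g := H) z hH.hasFDerivAt h1
  rw [dirDeriv, show (fun z : ℂ × ℂ => H (z.1, t)) = H ∘ fun z => (z.1, t) from rfl, h2.fderiv]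
  simp [dirDeriv]

theorem dirDeriv_const (v : ℂ × ℂ) (a : ℂ) (z : ℂ × ℂ) : dirDeriv v (fun _ => a) z = 0 := by
  simp [dirDeriv]

/-- The system is the same for every local logarithm `M`. The equation for `w` carries the extra
factor `A (B ^ 2 - V ^ 2 δ)` so that both share one leading coefficient. -/
theorem exists_logMatrix {D : Set (ℂ × ℂ)} {F w : ℂ × ℂ → ℂ}
    {δ A V B : PolyXT} (hQ : IsQuadraticOn D F w δ A V B) (d : Derivation ℂ PolyXT PolyXT)
    (dir : ℂ × ℂ)
    (hd : ∀ P z, dirDeriv dir (fun z => polyVal z.1 z.2 P) z = polyVal z.1 z.2 (d P)) :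
    ∃ a E H : PolyXT, ∀ (Ω : Set (ℂ × ℂ)) (M : ℂ × ℂ → ℂ), IsOpen Ω → Ω ⊆ D →
      AnalyticOnNhd ℂ M Ω → (∀ z ∈ Ω, F z = Complex.exp (M z)) → ∀ z ∈ Ω,
      polyVal z.1 z.2 (2 * δ * A * (B ^ 2 - V ^ 2 * δ)) * dirDeriv dir w z =
        polyVal z.1 z.2 a * w z ∧
      polyVal z.1 z.2 (2 * δ * A * (B ^ 2 - V ^ 2 * δ)) * dirDeriv dir M z =
        polyVal z.1 z.2 E * w z + polyVal z.1 z.2 H := by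
  refine ⟨A * (B ^ 2 - V ^ 2 * δ) * d δ, _, _, fun Ω M hΩ hΩD hM hFM z hz => ⟨?_,
    IsQuadraticOn.dirDeriv_log hΩ ⟨hQ.1.mono hΩD, hQ.2.1, hQ.2.2.1, hQ.2.2.2.1,
      fun z hz => hQ.2.2.2.2 z (hΩD hz)⟩ hM hFM hz (hd δ z) (hd A z) (hd V z) (hd B z)⟩⟩
  have h1 := IsQuadraticOn.dirDeriv_sqrt hΩ ⟨hQ.1.mono hΩD, hQ.2.1, hQ.2.2.1, hQ.2.2.2.1,
      fun z hz => hQ.2.2.2.2 z (hΩD hz)⟩ hz (hd δ z)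
  simp only [map_mul, map_ofNat]
  linear_combination polyVal z.1 z.2 A * polyVal z.1 z.2 (B ^ 2 - V ^ 2 * δ) * h1

/-- The exponential of a kernel integral of the logarithm of `F` is D-algebraic. -/
theorem isDAlgebraicOn_of_kernel {D : Set (ℂ × ℂ)} {F w : ℂ × ℂ → ℂ} {δ A V B : PolyXT}
    (hQ : IsQuadraticOn D F w δ A V B) {num : PolyXT[X]} {κ : ℂ → ℂ → ℂ}
    (hκ : ∀ s x t : ℂ, s ≠ 0 → s ≠ x → s * (s - x) * κ s x = num.eval₂ (polyVal x t) s)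
    (hκa : ∀ s x : ℂ, s ≠ 0 → s ≠ x → AnalyticAt ℂ (fun z : ℂ × ℂ => κ z.1 z.2) (s, x))
    {g : ℂ → ℂ → ℂ} (hg : ∀ z₀ ∈ D, ∃ (Ω : Set (ℂ × ℂ)) (M : ℂ × ℂ → ℂ) (r : ℝ), IsOpen Ω ∧
      Ω ⊆ D ∧ AnalyticOnNhd ℂ M Ω ∧ (∀ z ∈ Ω, F z = Complex.exp (M z)) ∧ 0 < r ∧ r ≠ ‖z₀.1‖ ∧
      (∀ s ∈ sphere (0 : ℂ) r, (s, z₀.2) ∈ Ω) ∧ ∀ᶠ z in 𝓝 z₀, g z.1 z.2 =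
        Complex.exp ((2 * (Real.pi : ℂ) * Complex.I)⁻¹ *
          ∮ s in C(0, r), M (s, z.2) * κ s z.1)) :
    IsDAlgebraicOn D g := by
  have hsphere : ∀ {r : ℝ} {x : ℂ}, 0 < r → r ≠ ‖x‖ → ∀ s ∈ sphere (0 : ℂ) r, s ≠ 0 ∧ s ≠ x := by
    intro r x hr hrx s hs
    rw [mem_sphere_zero_iff_norm] at hs
    refine ⟨fun h => ?_, fun h => ?_⟩
    · rw [h, norm_zero] at hs; exact hr.ne hs
    · rw [h] at hs; exact hrx hs.symm
  have hint : ∀ (Ω : Set (ℂ × ℂ)) (M : ℂ × ℂ → ℂ) (r : ℝ) (z₀ : ℂ × ℂ), IsOpen Ω →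
      AnalyticOnNhd ℂ M Ω → 0 < r → r ≠ ‖z₀.1‖ → (∀ s ∈ sphere (0 : ℂ) r, (s, z₀.2) ∈ Ω) →
      AnalyticAt ℂ (fun z : ℂ × ℂ => ∮ s in C(0, r), M (s, z.2) * κ s z.1) z₀ := by
    intro Ω M r z₀ hΩ hM hr hrz hs
    refine analyticAt_circleIntegral (F := fun y : ℂ × ℂ × ℂ => M (y.1, y.2.2) * κ y.1 y.2.1)
      (Ω := {y | (y.1, y.2.2) ∈ Ω ∧ y.1 ≠ 0 ∧ y.1 ≠ y.2.1}) ?_ ?_ hr.le ?_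
    · refine (hΩ.preimage (by fun_prop : Continuous fun y : ℂ × ℂ × ℂ => (y.1, y.2.2))).inter
        ((isOpen_ne_fun continuous_fst continuous_const).inter
          (isOpen_ne_fun continuous_fst (by fun_prop)))
    · rintro y ⟨h1, h2, h3⟩
      exact (AnalyticAt.comp (g := M) (f := fun y : ℂ × ℂ × ℂ => (y.1, y.2.2)) (x := y) (hM _ h1)
        (analyticAt_fst.prod (analyticAt_snd.comp analyticAt_snd))).mul (AnalyticAt.comp (g := fun z : ℂ × ℂ => κ z.1 z.2)
          (f := fun y : ℂ × ℂ × ℂ => (y.1, y.2.1)) (x := y) (hκa _ _ h2 h3)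
          (analyticAt_fst.prod (analyticAt_fst.comp analyticAt_snd)))
    · exact fun s hsr => ⟨hs s hsr, hsphere hr hrz s hsr⟩
  set Mp : PolyXT := 2 * δ * A * (B ^ 2 - V ^ 2 * δ) with hMp
  have hMp0 : Mp ≠ 0 := mul_ne_zero (mul_ne_zero (mul_ne_zero two_ne_zero hQ.2.1) hQ.2.2.1)
    hQ.2.2.2.1
  obtain ⟨a₀, E₀, H₀, h0⟩ := exists_logMatrix hQ (MvPolynomial.pderiv 0) (1, 0)
    dirDeriv_polyVal_left
  obtain ⟨a₁, E₁, H₁, h1⟩ := exists_logMatrix hQ (MvPolynomial.pderiv 1) (0, 1)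
    dirDeriv_polyVal_right
  set U : PolyXT[X] := substX Mp * kernelDen with hU
  have hU0 : U ≠ 0 := mul_ne_zero (substX_ne_zero hMp0) kernelDen_ne_zero
  set v : Fin 3 → PolyXT[X] := ![0, 0, substX Mp * num] with hv
  -- Where the leading coefficient of `U` vanishes, `U` may vanish identically in `s` and the linear
  -- equation is unavailable. The final differential equations are therefore multiplied by that
  -- coefficient.
  have hlead : ∀ e : PolyXT →+* ℂ, e U.leadingCoeff ≠ 0 → U.map e ≠ 0 := fun e he h => he (by
    have := congrArg (fun Q => Q.coeff U.natDegree) h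
    simpa using this)
  refine ⟨fun z hz => ?_, ?_, ?_⟩
  · obtain ⟨Ω, M, r, hΩ, hΩD, hM, hFM, hr, hrz, hs, hev⟩ := hg z hz
    exact (analyticAt_const.mul (hint Ω M r z hΩ hM hr hrz hs)).cexp.congr
      (hev.mono fun y hy => hy.symm)
  -- Equation in `x`: the functions `1, w(s, t), M(s, t)` do not depend on `x`, so the matrix of the
  -- parameter derivation is `0`.
  · obtain ⟨N, c, hc, hode⟩ := exists_linearODE_circleIntegral (MvPolynomial.pderiv 0) U
      (logMatrix a₀ E₀ H₀) 0 v
    refine ⟨MvPolynomial.C U.leadingCoeff * expODE PolyXT c, mul_ne_zero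
      (by simpa using hU0) (expODE_ne_zero PolyXT hc), fun x t hz => ?_⟩
    obtain ⟨Ω, M, r, hΩ, hΩD, hM, hFM, hr, hrz, hs, hev⟩ := hg (x, t) hz
    rw [MvPolynomial.eval₂_mul, MvPolynomial.eval₂_C]
    by_cases hu : polyVal x t U.leadingCoeff = 0
    · rw [hu, zero_mul]
    have hana := hint Ω M r (x, t) hΩ hM hr hrz hs
    refine mul_eq_zero_of_right _ (eval₂_expODE_circleIntegral
      (I := fun σ => ∮ s in C(0, r), M (s, t) * κ s σ)
      (a := (2 * (Real.pi : ℂ) * Complex.I)⁻¹) ?_ ?_ ?_)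
    · exact AnalyticAt.comp (g := fun z : ℂ × ℂ => ∮ s in C(0, r), M (s, z.2) * κ s z.1)
        (f := fun σ => (σ, t)) (x := x) hana (by fun_prop)
    · exact (show Continuous fun σ : ℂ => (σ, t) by fun_prop).continuousAt.eventually hev
    · set Ω' : Set (ℂ × ℂ) := {z | (z.1, t) ∈ Ω ∧ z.1 ≠ 0 ∧ z.1 ≠ z.2}
      have hev1 : ∀ (P : PolyXT) (z : ℂ × ℂ),
          evalAt (fun σ => polyVal σ t) (substX P) z = polyVal z.1 t P :=
        fun P z => eval₂_substX _ _ _ _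
      have hev2 : ∀ z : ℂ × ℂ, evalAt (fun σ => polyVal σ t) kernelDen z = z.1 * (z.1 - z.2) :=
        fun z => eval₂_kernelDen _ _ _
      have hev3 : ∀ (P Q : PolyXT[X]) (z : ℂ × ℂ), evalAt (fun σ => polyVal σ t) (P * Q) z =
          evalAt (fun σ => polyVal σ t) P z * evalAt (fun σ => polyVal σ t) Q z :=
        fun P Q z => eval₂_mul _ _
      have hev4 : ∀ z : ℂ × ℂ, evalAt (fun σ => polyVal σ t) 0 z = 0 := fun z => eval₂_zero _ _
      have hcomp : ∀ {H : ℂ × ℂ → ℂ}, AnalyticOnNhd ℂ H Ω →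
          AnalyticOnNhd ℂ (fun z : ℂ × ℂ => H (z.1, t)) Ω' := fun hH z hz =>
        AnalyticAt.comp (f := fun z : ℂ × ℂ => (z.1, t)) (x := z) (hH _ hz.1)
          (analyticAt_fst.prod analyticAt_const)
      have hwΩ := hQ.1.mono hΩD
      refine hode (fun σ => polyVal σ t) (fun P τ => hasDerivAt_polyVal_left t P τ) Ω'
        (fun z => M (z.1, t) * κ z.1 z.2)
        ![fun _ => 1, fun z => w (z.1, t), fun z => M (z.1, t)] r x ?_ hr.le ?_
        (hlead _ hu) ?_ ?_ ?_ ?_ ?_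
      · exact (hΩ.preimage (by fun_prop : Continuous fun z : ℂ × ℂ => (z.1, t))).inter
          ((isOpen_ne_fun continuous_fst continuous_const).inter
            (isOpen_ne_fun continuous_fst continuous_snd))
      · exact fun s hsr => ⟨hs s hsr, hsphere hr hrz s hsr⟩
      · exact fun z hz => (hcomp hM z hz).mul (hκa _ _ hz.2.1 hz.2.2)
      · intro b
        fin_cases b
        · exact fun _ _ => analyticAt_const
        · exact hcomp hwΩ
        · exact hcomp hM
      · intro b z hz
        have h2 := h0 Ω M hΩ hΩD hM hFM _ hz.1
        fin_cases b
        · simp [dirDeriv_const, logMatrix, hev4]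
        · simp only [Fin.sum_univ_three, logMatrix, hU, hev3, hev1, hev2]
          simp [dirDeriv_comp_fst _ (hwΩ _ hz.1).differentiableAt, hev4, hev3, hev1, hev2]
          linear_combination z.1 * (z.1 - z.2) * h2.1
        · simp only [Fin.sum_univ_three, logMatrix, hU, hev3, hev1, hev2]
          simp [dirDeriv_comp_fst _ (hM _ hz.1).differentiableAt, hev4, hev3, hev1, hev2]
          linear_combination z.1 * (z.1 - z.2) * h2.2
      · intro b z hz
        have hz0 : ∀ H : ℂ × ℂ → ℂ, dirDeriv (0, 0) H (z.1, t) = 0 := fun H =>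
          (fderiv ℂ H (z.1, t)).map_zero
        fin_cases b
        · simp [dirDeriv_const, hev4]
        · simp [dirDeriv_comp_fst _ (hwΩ _ hz.1).differentiableAt, hev4, hz0]
        · simp [dirDeriv_comp_fst _ (hM _ hz.1).differentiableAt, hev4, hz0]
      · intro z hz
        have h3 : evalAt (fun σ => polyVal σ t) num z = z.1 * (z.1 - z.2) * κ z.1 z.2 :=
          (hκ _ _ t hz.2.1 hz.2.2).symm
        simp only [Fin.sum_univ_three, hU, hv, hev3, hev1, hev2]
        simp [hev4, hev3, hev1, h3]
        ring
  -- Equation in `t`: now `x` is frozen in the kernel, and both derivations act on `1, w, M`.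
  · obtain ⟨N, c, hc, hode⟩ := exists_linearODE_circleIntegral (MvPolynomial.pderiv 1) U
      (logMatrix a₀ E₀ H₀) (logMatrix a₁ E₁ H₁) v
    refine ⟨MvPolynomial.C U.leadingCoeff * expODE PolyXT c, mul_ne_zero
      (by simpa using hU0) (expODE_ne_zero PolyXT hc), fun x t hz => ?_⟩
    obtain ⟨Ω, M, r, hΩ, hΩD, hM, hFM, hr, hrz, hs, hev⟩ := hg (x, t) hz
    rw [MvPolynomial.eval₂_mul, MvPolynomial.eval₂_C]
    by_cases hu : polyVal x t U.leadingCoeff = 0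
    · rw [hu, zero_mul]
    have hana := hint Ω M r (x, t) hΩ hM hr hrz hs
    refine mul_eq_zero_of_right _ (eval₂_expODE_circleIntegral
      (I := fun σ => ∮ s in C(0, r), M (s, σ) * κ s x)
      (a := (2 * (Real.pi : ℂ) * Complex.I)⁻¹) ?_ ?_ ?_)
    · exact AnalyticAt.comp (g := fun z : ℂ × ℂ => ∮ s in C(0, r), M (s, z.2) * κ s z.1)
        (f := fun σ => (x, σ)) (x := t) hana (by fun_prop)
    · exact (show Continuous fun σ : ℂ => (x, σ) by fun_prop).continuousAt.eventually hev
    · set Ω' : Set (ℂ × ℂ) := {z | z ∈ Ω ∧ z.1 ≠ 0 ∧ z.1 ≠ x}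
      have hev1 : ∀ (P : PolyXT) (z : ℂ × ℂ),
          evalAt (fun σ => polyVal x σ) (substX P) z = polyVal z.1 z.2 P :=
        fun P z => eval₂_substX _ _ _ _
      have hev2 : ∀ z : ℂ × ℂ, evalAt (fun σ => polyVal x σ) kernelDen z = z.1 * (z.1 - x) :=
        fun z => eval₂_kernelDen _ _ _
      have hev3 : ∀ (P Q : PolyXT[X]) (z : ℂ × ℂ), evalAt (fun σ => polyVal x σ) (P * Q) z =
          evalAt (fun σ => polyVal x σ) P z * evalAt (fun σ => polyVal x σ) Q z :=
        fun P Q z => eval₂_mul _ _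
      have hev4 : ∀ z : ℂ × ℂ, evalAt (fun σ => polyVal x σ) 0 z = 0 := fun z => eval₂_zero _ _
      have hsub : Ω' ⊆ Ω := fun z hz => hz.1
      have hwΩ := hQ.1.mono hΩD
      refine hode (fun σ => polyVal x σ) (fun P τ => hasDerivAt_polyVal_right x P τ) Ω'
        (fun z => M z * κ z.1 x) ![fun _ => 1, w, M] r t ?_ hr.le ?_
        (hlead _ hu) ?_ ?_ ?_ ?_ ?_
      · exact hΩ.inter ((isOpen_ne_fun continuous_fst continuous_const).inter
            (isOpen_ne_fun continuous_fst continuous_const))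
      · exact fun s hsr => ⟨hs s hsr, hsphere hr hrz s hsr⟩
      · exact fun z hz => (hM z hz.1).mul (AnalyticAt.comp (g := fun z : ℂ × ℂ => κ z.1 z.2)
          (f := fun z : ℂ × ℂ => (z.1, x)) (x := z) (hκa _ _ hz.2.1 hz.2.2)
          (analyticAt_fst.prod analyticAt_const))
      · intro b
        fin_cases b
        · exact fun _ _ => analyticAt_const
        · exact hwΩ.mono hsub
        · exact hM.mono hsub
      · intro b z hz
        have h2 := h0 Ω M hΩ hΩD hM hFM _ hz.1
        fin_cases b
        · simp [dirDeriv_const, logMatrix, hev4]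
        · simp only [Fin.sum_univ_three, logMatrix, hU, hev3, hev1, hev2]
          simp [hev4, hev3, hev1, hev2]
          linear_combination z.1 * (z.1 - x) * h2.1
        · simp only [Fin.sum_univ_three, logMatrix, hU, hev3, hev1, hev2]
          simp [hev4, hev3, hev1, hev2]
          linear_combination z.1 * (z.1 - x) * h2.2
      · intro b z hz
        have h2 := h1 Ω M hΩ hΩD hM hFM _ hz.1
        fin_cases b
        · simp [dirDeriv_const, logMatrix, hev4]
        · simp only [Fin.sum_univ_three, logMatrix, hU, hev3, hev1, hev2]
          simp [hev4, hev3, hev1, hev2]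
          linear_combination z.1 * (z.1 - x) * h2.1
        · simp only [Fin.sum_univ_three, logMatrix, hU, hev3, hev1, hev2]
          simp [hev4, hev3, hev1, hev2]
          linear_combination z.1 * (z.1 - x) * h2.2
      · intro z hz
        have h3 : evalAt (fun σ => polyVal x σ) num z = z.1 * (z.1 - x) * κ z.1 x :=
          (hκ _ _ z.2 hz.2.1 hz.2.2).symm
        simp only [Fin.sum_univ_three, hU, hv, hev3, hev1, hev2]
        simp [hev4, hev3, hev1, h3]
        ring

end KernelIntegral

/-! ### The Laurent parts of `L`, and the theorem. -/

section Main
open Topology Metric Complex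

variable {T : Set ℂ} {ρ R : ℂ → ℝ}

/-- The exponential of a part of the Laurent expansion of `L(·, t)` is locally the exponential of a
kernel integral of a logarithm that is analytic in both variables. -/
theorem eventually_exp_part_eq (hρ_nonneg : ∀ t ∈ T, 0 ≤ ρ t) {Ω : Set (ℂ × ℂ)} (hΩ : IsOpen Ω)
    (hΩD : Ω ⊆ annularDomain T ρ R) {F M : ℂ × ℂ → ℂ} (hM : AnalyticOnNhd ℂ M Ω)
    (hFM : ∀ z ∈ Ω, F z = exp (M z)) {L : ℂ → ℂ → ℂ}
    (hL : ∀ t ∈ T, DifferentiableOn ℂ (fun x => L x t) (openAnnulus (ρ t) (R t)))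
    (hFL : ∀ z ∈ annularDomain T ρ R, F z = exp (L z.1 z.2)) {κ : ℂ → ℂ → ℂ}
    (hκa : ∀ s x : ℂ, s ≠ 0 → s ≠ x → AnalyticAt ℂ (fun z : ℂ × ℂ => κ z.1 z.2) (s, x))
    {part : ℝ → ℝ → (ℂ → ℂ) → ℂ → ℂ} {r : ℝ} (hr : 0 < r) {z₀ : ℂ × ℂ} (hrz : r ≠ ‖z₀.1‖)
    (hsph : ∀ s ∈ sphere (0 : ℂ) r, (s, z₀.2) ∈ Ω)
    (hpart : ∀ᶠ x in 𝓝 z₀.1, (∃ n : ℤ, (∮ s in C(0, r), κ s x) = n * (2 * Real.pi * I)) ∧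
      ∀ (a b : ℝ) (g : ℂ → ℂ), 0 ≤ a → a < r → r < b → DifferentiableOn ℂ g (openAnnulus a b) →
        part a b g x = (2 * (Real.pi : ℂ) * I)⁻¹ * ∮ s in C(0, r), g s * κ s x) :
    ∀ᶠ z in 𝓝 z₀, exp (part (ρ z.2) (R z.2) (fun s => L s z.2) z.1) =
      exp ((2 * (Real.pi : ℂ) * I)⁻¹ * ∮ s in C(0, r), M (s, z.2) * κ s z.1) := by
  have h1 : ∀ᶠ z : ℂ × ℂ in 𝓝 z₀, r ≠ ‖z.1‖ :=
    (show Continuous fun z : ℂ × ℂ => ‖z.1‖ by fun_prop).continuousAt.eventually_ne hrz.symm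
      |>.mono fun z hz => hz.symm
  filter_upwards [h1, continuousAt_fst.eventually hpart,
    continuousAt_snd.eventually (eventually_forall_sphere hΩ hsph)] with z hz1 hz2 hz3
  obtain ⟨⟨n', hn'⟩, hp⟩ := hz2
  have hpt : (r : ℂ) ∈ sphere (0 : ℂ) r := by simp [abs_of_pos hr]
  obtain ⟨hT, hr1, hr2⟩ := hΩD (hz3 _ hpt)
  simp only [norm_real, Real.norm_eq_abs, abs_of_pos hr] at hr1 hr2
  have hsub := sphere_subset_openAnnulus hr1 hr2
  have hLc : ContinuousOn (fun s => L s z.2) (sphere 0 r) := (hL z.2 hT).continuousOn.mono hsub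
  have hMc : ContinuousOn (fun s => M (s, z.2)) (sphere 0 r) :=
    hM.continuousOn.comp (by fun_prop) hz3
  have hκc : ContinuousOn (fun s => κ s z.1) (sphere 0 r) := fun s hs => by
    rw [mem_sphere_zero_iff_norm] at hs
    have h2 : AnalyticAt ℂ (fun z : ℂ × ℂ => κ z.1 z.2) (s, z.1) :=
      hκa s z.1 (fun h => hr.ne (by rw [← hs, h, norm_zero])) fun h => hz1 (by rw [← hs, h])
    exact (ContinuousAt.comp (f := fun s => (s, z.1)) (x := s) h2.continuousAt
      (by fun_prop)).continuousWithinAt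
  -- Two logarithms of `F(·, t)` on the connected circle differ by a constant `2πi n`. After
  -- division by `2πi` it contributes `n ∮ κ = 2πi n n'` to the exponent, which `exp` ignores.
  obtain ⟨n, hn⟩ := exists_int_of_exp_eq_one
    (isPreconnected_sphere (by rw [rank_real_complex]; norm_num) (0 : ℂ) r)
    (c := fun s => M (s, z.2) - L s z.2) (hMc.sub hLc) fun s hs => by
      rw [exp_sub, ← hFM _ (hz3 s hs), ← hFL _ (hΩD (hz3 s hs))]
      refine div_self ?_
      rw [hFM _ (hz3 s hs)]
      exact exp_ne_zero _
  have hsplit : (∮ s in C(0, r), M (s, z.2) * κ s z.1) =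
      (∮ s in C(0, r), L s z.2 * κ s z.1) + n * (2 * Real.pi * I) * (n' * (2 * Real.pi * I)) := by
    rw [← hn', ← circleIntegral.integral_const_mul, ← circleIntegral.integral_add
      (f := fun s => L s z.2 * κ s z.1) (g := fun s => n * (2 * Real.pi * I) * κ s z.1)
      (ContinuousOn.circleIntegrable hr.le (hLc.mul hκc))
      (ContinuousOn.circleIntegrable hr.le (continuousOn_const.mul hκc))]
    refine circleIntegral.integral_congr hr.le fun s hs => ?_
    linear_combination κ s z.1 * hn s hs
  rw [hp _ _ _ (hρ_nonneg _ hT) hr1 hr2 (hL z.2 hT), hsplit, mul_add, exp_add]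
  have : (2 * (Real.pi : ℂ) * I)⁻¹ * (n * (2 * Real.pi * I) * (n' * (2 * Real.pi * I))) =
      ((n * n' : ℤ) : ℂ) * (2 * Real.pi * I) := by
    have := two_pi_I_ne_zero
    push_cast
    field_simp
  rw [this, exp_int_mul_two_pi_mul_I, mul_one]

/-- The hypothesis `hpart` isolates what the three Laurent parts share: a radius off `‖x₀‖`, a
kernel formula uniform in the annulus and in `x` near `x₀`, and a kernel integral in `2πi ℤ`. -/
theorem isDAlgebraicOn_exp_part (hρ_nonneg : ∀ t ∈ T, 0 ≤ ρ t)
    (hD : IsOpen (annularDomain T ρ R)) {F w : ℂ × ℂ → ℂ} {δ A V B : PolyXT}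
    (hQ : IsQuadraticOn (annularDomain T ρ R) F w δ A V B)
    (hF : AnalyticOnNhd ℂ F (annularDomain T ρ R)) {L : ℂ → ℂ → ℂ}
    (hL : ∀ t ∈ T, DifferentiableOn ℂ (fun x => L x t) (openAnnulus (ρ t) (R t)))
    (hFL : ∀ z ∈ annularDomain T ρ R, F z = exp (L z.1 z.2))
    {num : Polynomial PolyXT} {κ : ℂ → ℂ → ℂ}
    (hκ : ∀ s x t : ℂ, s ≠ 0 → s ≠ x → s * (s - x) * κ s x = num.eval₂ (polyVal x t) s)
    (hκa : ∀ s x : ℂ, s ≠ 0 → s ≠ x → AnalyticAt ℂ (fun z : ℂ × ℂ => κ z.1 z.2) (s, x))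
    {part : ℝ → ℝ → (ℂ → ℂ) → ℂ → ℂ}
    (hpart : ∀ (a₀ b₀ : ℝ) (x₀ : ℂ), 0 ≤ a₀ → x₀ ∈ openAnnulus a₀ b₀ → ∃ r, a₀ < r ∧ r < b₀ ∧
      r ≠ ‖x₀‖ ∧ ∀ᶠ x in 𝓝 x₀, (∃ n : ℤ, (∮ s in C(0, r), κ s x) = n * (2 * Real.pi * I)) ∧
      ∀ (a b : ℝ) (g : ℂ → ℂ), 0 ≤ a → a < r → r < b → DifferentiableOn ℂ g (openAnnulus a b) →
        part a b g x = (2 * (Real.pi : ℂ) * I)⁻¹ * ∮ s in C(0, r), g s * κ s x) :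
    IsDAlgebraicOn (annularDomain T ρ R)
      (fun x t => exp (part (ρ t) (R t) (fun s => L s t) x)) := by
  refine isDAlgebraicOn_of_kernel hQ hκ hκa fun z₀ hz₀ => ?_
  obtain ⟨r, hr1, hr2, hrz, hp⟩ := hpart _ _ _ (hρ_nonneg _ hz₀.1) hz₀.2
  have hr : 0 < r := (hρ_nonneg _ hz₀.1).trans_lt hr1
  obtain ⟨Ω, M, hΩ, hΩD, hM, hV, hFM⟩ := exists_local_log hD hF
    (isOpen_openAnnulus (ρ z₀.2) (R z₀.2)) (t₀ := z₀.2) (fun s hs => ⟨hz₀.1, hs⟩)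
    (hL _ hz₀.1) (fun s hs => hFL (s, z₀.2) ⟨hz₀.1, hs⟩)
    (fun z hz => by rw [hFL z hz]; exact exp_ne_zero _)
  have hsph : ∀ s ∈ sphere (0 : ℂ) r, (s, z₀.2) ∈ Ω := fun s hs =>
    hV s (sphere_subset_openAnnulus hr1 hr2 hs)
  exact ⟨Ω, M, r, hΩ, hΩD, hM, hFM, hr, hrz, hsph,
    eventually_exp_part_eq hρ_nonneg hΩ hΩD hM hFM hL hFL hκa hr hrz hsph hp⟩

/-- The kernel is `1 / (s - x) - 1 / s`, and the circle surrounds both poles. -/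
theorem circleIntegral_posKernel {r : ℝ} {x : ℂ} (hr : ‖x‖ < r) :
    (∮ s in C(0, r), x / (s * (s - x))) = 0 := by
  have hr0 : 0 < r := (norm_nonneg x).trans_lt hr
  have hs0 : ∀ s ∈ sphere (0 : ℂ) r, s ≠ 0 ∧ s - x ≠ 0 := fun s hs => by
    rw [mem_sphere_zero_iff_norm] at hs
    refine ⟨fun h => ?_, fun h => ?_⟩
    · rw [h, norm_zero] at hs; exact hr0.ne hs
    · rw [sub_eq_zero.1 h] at hs; exact hr.ne hs
  have h1 : CircleIntegrable (fun s : ℂ => (s - x)⁻¹) 0 r := ContinuousOn.circleIntegrable hr0.le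
    ((continuousOn_id.sub continuousOn_const).inv₀ fun s hs => (hs0 s hs).2)
  have h2 : CircleIntegrable (fun s : ℂ => (s - 0)⁻¹) 0 r := ContinuousOn.circleIntegrable hr0.le
    ((continuousOn_id.sub continuousOn_const).inv₀ fun s hs => by simpa using (hs0 s hs).1)
  rw [circleIntegral.integral_congr (g := fun s => (s - x)⁻¹ - (s - 0)⁻¹) hr0.le,
    circleIntegral.integral_sub h1 h2, circleIntegral.integral_sub_center_inv _ hr0.ne',
    circleIntegral.integral_sub_inv_of_mem_ball (by simpa using hr), sub_self]
  intro s hs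
  obtain ⟨h3, h4⟩ := hs0 s hs
  dsimp only
  rw [sub_zero]
  field_simp
  ring

end Main

theorem mainTheorem7
    (p q Δ : RatXT)
    (T : Set ℂ) (hT_open : IsOpen T) (hT_conn : IsConnected T) (hT_zero : (0 : ℂ) ∉ T)
    (ρ R : ℂ → ℝ) (hρ_cont : ContinuousOn ρ T) (hR_cont : ContinuousOn R T)
    (hρ_nonneg : ∀ t ∈ T, 0 ≤ ρ t) (hρR : ∀ t ∈ T, ρ t < R t)
    (f : ℂ → ℂ → ℂ) (hf : IsBranchOn p q Δ (annularDomain T ρ R) f)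
    (hf_ne : ∀ x t : ℂ, (x, t) ∈ annularDomain T ρ R → f x t ≠ 0) :
    (∃! k : ℤ, ∀ i : ℤ, ∃ L : ℂ → ℂ → ℂ, IsLogOn T ρ R f k i L) ∧
    ∀ (k i : ℤ) (L : ℂ → ℂ → ℂ), IsLogOn T ρ R f k i L →
      (∀ x t : ℂ, (x, t) ∈ annularDomain T ρ R →
        f x t = x ^ k * t ^ i * Complex.exp (logNeg ρ R L x t) *
          Complex.exp (logZero ρ R L x t) * Complex.exp (logPos ρ R L x t)) ∧
      IsDAlgebraicOn (annularDomain T ρ R) (fun x t => Complex.exp (logPos ρ R L x t)) ∧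
      IsDAlgebraicOn (annularDomain T ρ R) (fun x t => Complex.exp (logNeg ρ R L x t)) ∧
      IsDAlgebraicOn (annularDomain T ρ R) (fun x t => Complex.exp (logZero ρ R L x t)) := by
  have hD : IsOpen (annularDomain T ρ R) := isOpen_annularDomain hT_open hρ_cont hR_cont
  refine ⟨existsUnique_isLogOn hT_open hT_conn hT_zero hρ_cont hR_cont hρ_nonneg hρR hf.1 hf_ne,
    fun k i L hL => ?_⟩
  have hne : (annularDomain T ρ R).Nonempty := by
    obtain ⟨t, ht⟩ := hT_conn.nonempty
    have h1 := hρ_nonneg t ht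
    have h2 := hρR t ht
    have h3 : ‖((((ρ t + R t) / 2 : ℝ)) : ℂ)‖ = (ρ t + R t) / 2 := by
      rw [Complex.norm_real, Real.norm_eq_abs, abs_of_nonneg (by linarith)]
    refine ⟨((((ρ t + R t) / 2 : ℝ) : ℂ), t), ht, ?_, ?_⟩ <;> rw [h3] <;> linarith
  have hx0 : ∀ z ∈ annularDomain T ρ R, z.1 ≠ 0 := fun z hz =>
    ne_zero_of_mem_openAnnulus (hρ_nonneg _ hz.1) hz.2
  have ht0 : ∀ z ∈ annularDomain T ρ R, z.2 ≠ 0 := fun z hz h => hT_zero (h ▸ hz.1)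
  obtain ⟨w, δ, A₀, V₀, B₀, hQ₀⟩ := hf.exists_isQuadraticOn hD hne hf_ne
  set F : ℂ × ℂ → ℂ := fun z => z.1 ^ (-k) * z.2 ^ (-i) * f z.1 z.2 with hF
  have hfF : ∀ z ∈ annularDomain T ρ R, f z.1 z.2 = z.1 ^ k * z.2 ^ i * F z := fun z hz => by
    have h1 := zpow_ne_zero k (hx0 z hz)
    have h2 := zpow_ne_zero i (ht0 z hz)
    simp only [hF, zpow_neg]
    field_simp
  obtain ⟨A, V, B, hQ⟩ := hQ₀.zpow_mul hx0 ht0 k i hfF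
  have hFa : AnalyticOnNhd ℂ F (annularDomain T ρ R) := fun z hz =>
    ((analyticAt_fst.zpow (hx0 z hz)).mul (analyticAt_snd.zpow (ht0 z hz))).mul (hf.1 z hz)
  have hLd : ∀ t ∈ T, DifferentiableOn ℂ (fun x => L x t) (openAnnulus (ρ t) (R t)) :=
    fun t ht => (hL t ht).1
  have hFL : ∀ z ∈ annularDomain T ρ R, F z = Complex.exp (L z.1 z.2) := fun z hz => by
    have h1 := zpow_ne_zero k (hx0 z hz)
    have h2 := zpow_ne_zero i (ht0 z hz)
    simp only [hF, zpow_neg]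
    rw [(hL z.2 hz.1).2 z.1 hz.2]
    field_simp
  refine ⟨fun x t hz => ?_, ?_, ?_, ?_⟩
  · have h1 := negPart_add_laurentCoeff_add_posPart (hρ_nonneg t hz.1) (hLd t hz.1) hz.2
    rw [(hL t hz.1).2 x hz.2, ← h1, Complex.exp_add, Complex.exp_add, ← mul_assoc, ← mul_assoc]
    rfl
  -- Positive part: the circle is taken outside `‖x₀‖`, where the kernel has integral `0`.
  · refine isDAlgebraicOn_exp_part hρ_nonneg hD hQ hFa hLd hFL
      (num := Polynomial.C (MvPolynomial.X 0)) (κ := fun s x => x / (s * (s - x)))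
      (part := _root_.posPart) (fun s x t hs hsx => ?_) (fun s x hs hsx => ?_)
      fun a₀ b₀ x₀ ha₀ hx₀ => ?_
    · have := sub_ne_zero.2 hsx
      simp only [Polynomial.eval₂_C, polyVal, MvPolynomial.eval_X, Matrix.cons_val_zero]
      field_simp
    · exact analyticAt_snd.div (analyticAt_fst.mul (analyticAt_fst.sub analyticAt_snd))
        (mul_ne_zero hs (sub_ne_zero.2 hsx))
    · obtain ⟨r, hr1, hr2⟩ := exists_between hx₀.2
      refine ⟨r, hx₀.1.trans hr1, hr2, hr1.ne', ?_⟩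
      filter_upwards [continuous_norm.continuousAt.eventually_lt continuousAt_const hr1] with x hx
      exact ⟨⟨0, by simpa using circleIntegral_posKernel hx⟩,
        fun a b g ha har hrb hg => posPart_eq ha hg har hrb hx⟩
  -- Negative part: the circle is taken inside `‖x₀‖`, so the pole at `x` is not enclosed.
  · refine isDAlgebraicOn_exp_part hρ_nonneg hD hQ hFa hLd hFL
      (num := -Polynomial.X) (κ := fun s x => -1 / (s - x))
      (part := _root_.negPart) (fun s x t hs hsx => ?_) (fun s x hs hsx => ?_)
      fun a₀ b₀ x₀ ha₀ hx₀ => ?_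
    · have := sub_ne_zero.2 hsx
      simp only [Polynomial.eval₂_neg, Polynomial.eval₂_X]
      field_simp
    · exact analyticAt_const.div (analyticAt_fst.sub analyticAt_snd) (sub_ne_zero.2 hsx)
    · obtain ⟨r, hr1, hr2⟩ := exists_between hx₀.1
      refine ⟨r, hr1, hr2.trans hx₀.2, hr2.ne, ?_⟩
      filter_upwards [continuousAt_const.eventually_lt continuous_norm.continuousAt hr2] with x hx
      refine ⟨⟨0, ?_⟩, fun a b g ha har hrb hg => negPart_eq ha hg har hrb hx⟩
      have h1 := circleIntegral_sub_inv_of_lt (ha₀.trans hr1.le) hx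
      have h2 : (∮ s in C(0, r), -1 / (s - x)) = ∮ s in C(0, r), -1 * (s - x)⁻¹ := by
        simp only [div_eq_mul_inv]
      rw [h2, circleIntegral.integral_const_mul, h1]
      simp
  -- Constant term: the numerator `s - x` cancels the factor of `kernelDen` that `1 / s` does not
  -- need. Here `∮ κ = 2πi`, so the integer is `1` and only the exponential is insensitive to the
  -- branch.
  · refine isDAlgebraicOn_exp_part hρ_nonneg hD hQ hFa hLd hFL
      (num := Polynomial.X - Polynomial.C (MvPolynomial.X 0)) (κ := fun s _ => 1 / s)
      (part := fun a b g _ => laurentCoeff a b g 0) (fun s x t hs hsx => ?_)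
      (fun s x hs hsx => ?_) fun a₀ b₀ x₀ ha₀ hx₀ => ?_
    · simp only [Polynomial.eval₂_sub, Polynomial.eval₂_X, Polynomial.eval₂_C, polyVal,
        MvPolynomial.eval_X, Matrix.cons_val_zero]
      field_simp
    · exact analyticAt_const.div analyticAt_fst hs
    · obtain ⟨r, hr1, hr2⟩ := exists_between hx₀.2
      have hr : 0 < r := (norm_nonneg x₀).trans_lt hr1
      refine ⟨r, hx₀.1.trans hr1, hr2, hr1.ne', .of_forall fun x => ⟨⟨1, ?_⟩,
        fun a b g ha har hrb hg => laurentCoeff_zero_eq ha hg har hrb⟩⟩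
      have h1 := circleIntegral.integral_sub_center_inv (0 : ℂ) hr.ne'
      simpa using h1
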